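/- **Theorem (PRI implies PRSG and PRFSG).** Let $n(\lambda),m(\lambda)$ be polynomially bounded, and let $F=\{F_\lambda\}$ be a $\mathcal Q_{\mathsf{Comp}}$-secure $(n,n+m)$-pseudorandom isometry. Then: 1. There is a quantum polynomial-time algorithm $G$ with $G_\lambda(k)=F_\lambda(k,|0^n\rangle\langle 0^n|)$ for every $k\in\{0,1\}^\lambda$, and $G$ is an $(n+m)$-qubit pseudorandom state generator (PRSG). 2. If moreover $2^{-(n(\lambda)+m(\lambda))}$ is negligible, i.e. $n+m=\omega(\log\lambda)$, then $(k,x)\mapsto F_\lambda(k,|x\rangle\langle x|)$ for $k\in\{0,1\}^\lambda$, $x\in\{0,1\}^n$ (with the classical input $|x\rangle$ kept alongside, as $|x\rangle\otimes F_k|x\rangle$) is a selectively secure $(n,n+m)$-pseudorandom function-like state generator (PRFSG). Here circuits are over a fixed finite set of unitary gates, may use ancilla qubits initialized to zero, and trace out the non-output qubits. A quantum polynomial-time (QPT) algorithm is a polynomial-size circuit family whose descriptions a deterministic polynomial-time Turing machine computes from $1^\lambda$. Distinguishers are families of polynomial-size circuits with one output bit, not necessarily uniform. Keys $k$ are uniform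 in $\{0,1\}^\lambda$. All of $q,\ell,s,t$ below range over polynomially bounded functions. *PRI:* $F$ is QPT; for every $k$, $F_\lambda(k,\cdot)$ is the channel of an isometry from $n$ to $n+m$ qubits; and for all $q,\ell$ and every distinguisher $D$ there is a negligible $\varepsilon$ such that for all sufficiently large $\lambda$, all $\ell$-qubit density matrices $\tau$ and all $x_1,\dots,x_q\in\{0,1\}^n$, with $\rho=\tau\otimes\bigotimes_{i}|x_i\rangle\langle x_i|$, $$\Big|\Pr_k[D_\lambda((I_\ell\otimes F_\lambda(k,\cdot)^{\otimes q})(\rho))=1]-\Pr_{\mathcal I}[D_\lambda((I_\ell\otimes\mathcal I^{\otimes q})(\rho))=1]\Big|\le\varepsilon(\lambda),$$ where $\mathcal I|\psi\rangle=U|\psi\rangle|0^m\rangle$ for a Haar-random $(n+m)$-qubit unitary $U$. *$N$-qubit PRSG:* a QPT algorithm $G$ such that for all $t$ and every distinguisher $D$ with polynomial-length quantum advice there is a negligible $\varepsilon$ with $|\Pr_k[D_\lambda(G_\lambda(k)^{\otimes t})=1]-\Pr_\vartheta[D_\lambda(|\vartheta\rangle^{\otimes t})=1]|\le\varepsilon(\lambda)$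 for all $\lambda$, where $|\vartheta\rangle$ is an $N$-qubit Haar state. *Selectively secure $(d,N)$-PRFSG:* a QPT algorithm $G$ such that for all $s,t$, every family of pairwise distinct $x_1,\dots,x_{s(\lambda)}\in\{0,1\}^{d(\lambda)}$ and every distinguisher $D$ with polynomial-length quantum advice there is a negligible $\varepsilon$ with $$\Big|\Pr_k[D_\lambda(x_1,\dots,x_s,G_\lambda(k,x_1)^{\otimes t},\dots,G_\lambda(k,x_s)^{\otimes t})=1]-\Pr_{\vartheta_1,\dots,\vartheta_s}[D_\lambda(x_1,\dots,x_s,|\vartheta_1\rangle^{\otimes t},\dots,|\vartheta_s\rangle^{\otimes t})=1]\Big|\le\varepsilon(\lambda)$$ for all $\lambda$, where the $|\vartheta_i\rangle$ are independent $N$-qubit Haar states. -/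

import Mathlib

noncomputable section

namespace QCrypto

open MeasureTheory Filter
open scoped ComplexOrder

/-! ## Registers, operators, tensor products -/

/-- Computational basis labels of an `n`-qubit register, i.e. `n`-bit strings. -/
abbrev Reg (n : ℕ) : Type := Fin n → Bool

/-- Linear operators on an `n`-qubit register, as matrices in the computational basis. -/
abbrev Op (n : ℕ) : Type := Matrix (Reg n) (Reg n) ℂ

/-- Density matrices of `n` qubits. -/
def IsDensity {n : ℕ} (ρ : Op n) : Prop := ρ.PosSemidef ∧ ρ.trace = 1

/-- `|v⟩⟨v|` for an amplitude vector `v`. -/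
def pureOp {n : ℕ} (v : Reg n → ℂ) : Op n := Matrix.vecMulVec v (star v)

/-- `|x⟩⟨x|` for a computational basis state `x`. -/
def basisOp {n : ℕ} (x : Reg n) : Op n := Matrix.single x x 1

/-- The all-zero string `0^n`. -/
def zeros (n : ℕ) : Reg n := fun _ => false

/-- First `a` bits of an `(a+b)`-bit string. -/
def fstPart {a b : ℕ} (x : Reg (a + b)) : Reg a := fun i => x (Fin.castAdd b i)

/-- Last `b` bits of an `(a+b)`-bit string. -/
def sndPart {a b : ℕ} (x : Reg (a + b)) : Reg b := fun i => x (Fin.natAdd a i)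

/-- The `i`-th of the `q` consecutive blocks of `n` bits of a `qn`-bit string. -/
def block {q n : ℕ} (x : Reg (q * n)) (i : Fin q) : Reg n := fun j => x (finProdFinEquiv (i, j))

/-- `ρ ⊗ σ`. -/
def tensor {a b : ℕ} (ρ : Op a) (σ : Op b) : Op (a + b) :=
  fun x y => ρ (fstPart x) (fstPart y) * σ (sndPart x) (sndPart y)

/-- `ρ 0 ⊗ ρ 1 ⊗ ⋯ ⊗ ρ (q-1)`. -/
def tensorAll {q n : ℕ} (ρ : Fin q → Op n) : Op (q * n) :=
  fun x y => ∏ i, ρ i (block x i) (block y i)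

/-- The operator `(I_ℓ ⊗ Φ^{⊗ q})(ρ)` for a linear map `Φ` from `n`-qubit operators to
`p`-qubit operators, obtained by expanding the last `qn` qubits of `ρ` in matrix units
`|u⟩⟨v| = ⨂ i, |u_i⟩⟨v_i|`. -/
def parallel {ℓ q n p : ℕ} (Φ : Op n → Op p) (ρ : Op (ℓ + q * n)) : Op (ℓ + q * p) :=
  fun x y => ∑ u : Reg (q * n), ∑ v : Reg (q * n),
    ρ (Fin.append (fstPart x) u) (Fin.append (fstPart y) v) *
      ∏ i, Φ (Matrix.single (block u i) (block v i) 1) (block (sndPart x) i) (block (sndPart y) i)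

/-! ## Quantum circuits -/

/-- A finite gate set, such as `{H, T, CNOT}`: finitely many unitary gates, each acting on a
fixed number of qubits. -/
structure GateSet where
  card : ℕ
  arity : Fin card → ℕ
  mat : (g : Fin card) → Matrix.unitaryGroup (Reg (arity g)) ℂ

/-- A gate of the gate set placed on an ordered tuple of distinct wires. -/
structure Gate (𝒢 : GateSet) (w : ℕ) where
  idx : Fin 𝒢.card
  pos : Fin (𝒢.arity idx) ↪ Fin w

/-- The operator of a placed gate: it acts on the wires in `pos` and as identity elsewhere. -/
def Gate.op {𝒢 : GateSet} {w : ℕ} (g : Gate 𝒢 w) : Op w := by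
  classical
  exact fun x y =>
    if ∀ i, i ∉ Set.range g.pos → x i = y i then
      (𝒢.mat g.idx : Matrix _ _ ℂ) (fun j => x (g.pos j)) (fun j => y (g.pos j))
    else 0

/-- A generalized quantum circuit with `inp` input qubits and `out` output qubits.
The input occupies the first `inp` wires, all other wires are initialized to zero, and all wires
that are not output wires are traced out at the end. -/
structure Circuit (𝒢 : GateSet) (inp out : ℕ) where
  wires : ℕ
  le : inp ≤ wires
  gates : List (Gate 𝒢 wires)
  output : Fin out ↪ Fin wires

namespace Circuit

variable {𝒢 : GateSet} {inp out : ℕ}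

/-- The unitary part of a circuit; the head of the gate list is applied first. -/
def unitary (C : Circuit 𝒢 inp out) : Op C.wires :=
  C.gates.foldl (fun U g => g.op * U) 1

/-- The input state on the first wires, tensored with zeros on the ancilla wires. -/
def initial (C : Circuit 𝒢 inp out) (ρ : Op inp) : Op C.wires :=
  fun x y =>
    if (∀ i : Fin C.wires, inp ≤ i.val → x i = false ∧ y i = false) then
      ρ (fun j => x (Fin.castLE C.le j)) (fun j => y (Fin.castLE C.le j))
    else 0

/-- Partial trace over all wires that are not output wires. -/
def traceOut (C : Circuit 𝒢 inp out) (σ : Op C.wires) : Op out := by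
  classical
  exact fun a b => ∑ x : Reg C.wires, ∑ y : Reg C.wires,
    if (∀ j, x (C.output j) = a j) ∧ (∀ j, y (C.output j) = b j) ∧
        (∀ i, i ∉ Set.range C.output → x i = y i) then σ x y else 0

/-- The quantum channel computed by a circuit. -/
def run (C : Circuit 𝒢 inp out) (ρ : Op inp) : Op out :=
  C.traceOut (C.unitary * C.initial ρ * C.unitary.conjTranspose)

/-- Number of gates plus number of wires (input, output and ancilla wires). -/
def size (C : Circuit 𝒢 inp out) : ℕ := C.gates.length + C.wires

/-- Self-delimiting code of a natural number. -/
def encNat (k : ℕ) : List Bool := List.replicate k true ++ [false]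

/-- The description of a circuit as a bit string: its number of wires, of gates, of output wires,
the list of its gates (name and wires) and the list of its output wires. The number of input wires
is not a part of it: a circuit family has a prescribed input length for each security parameter. -/
def describe (C : Circuit 𝒢 inp out) : List Bool :=
  encNat C.wires ++ encNat C.gates.length ++ encNat out ++
    C.gates.flatMap (fun g =>
      encNat g.idx ++ (List.ofFn fun j => encNat (g.pos j)).flatten) ++
    (List.ofFn fun j => encNat (C.output j)).flatten

/-- Probability that measuring the single output qubit of a circuit gives `1`. -/
def accept (D : Circuit 𝒢 inp 1) (ρ : Op inp) : ℝ :=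
  (D.run ρ (fun _ => true) (fun _ => true)).re

end Circuit

/-! ## Asymptotics and efficient algorithms -/

/-- `f` is bounded by a polynomial. -/
def PolyBounded (f : ℕ → ℕ) : Prop := ∃ p : Polynomial ℕ, ∀ κ, f κ ≤ p.eval κ

/-- Negligible functions: `κ ^ c * ε κ → 0` for every `c`. -/
def Negligible (ε : ℕ → ℝ) : Prop :=
  Asymptotics.SuperpolynomialDecay atTop (fun κ : ℕ => (κ : ℝ)) ε

/-- A family of circuits of polynomial size, not necessarily uniformly generated. -/
def IsPolySize {𝒢 : GateSet} {inp out : ℕ → ℕ} (C : (κ : ℕ) → Circuit 𝒢 (inp κ) (out κ)) : Prop :=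
  PolyBounded fun κ => (C κ).size

/-- A (uniform) quantum polynomial-time algorithm: a family of circuits of polynomial size, whose
descriptions are computed by a polynomial-time Turing machine from the security parameter in
unary. -/
def IsQPT {𝒢 : GateSet} {inp out : ℕ → ℕ} (C : (κ : ℕ) → Circuit 𝒢 (inp κ) (out κ)) : Prop :=
  IsPolySize C ∧
    Nonempty (Turing.TM2ComputableInPolyTime Computability.unaryEncodeNat
      (fun w : List Bool => w) fun κ => (C κ).describe)

/-- Average over a uniformly random key `k ∈ {0,1}^κ`. -/
def keyAvg {κ : ℕ} (f : Reg κ → ℝ) : ℝ := (∑ k, f k) / 2 ^ κ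

/-! ## Haar measure -/

instance instMeasurableSpaceUnitary (N : ℕ) :
    MeasurableSpace (Matrix.unitaryGroup (Reg N) ℂ) := borel _

instance instBorelSpaceUnitary (N : ℕ) : BorelSpace (Matrix.unitaryGroup (Reg N) ℂ) := ⟨rfl⟩

instance instCompactSpaceUnitary (N : ℕ) : CompactSpace (Matrix.unitaryGroup (Reg N) ℂ) := by
  have hb : IsCompact (Set.univ.pi fun _ : Reg N => Set.univ.pi fun _ : Reg N =>
      Metric.closedBall (0 : ℂ) 1) :=
    isCompact_univ_pi fun _ => isCompact_univ_pi fun _ => isCompact_closedBall 0 1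
  have hc : IsClosed {A : Op N | star A * A = 1 ∧ A * star A = 1} :=
    (isClosed_eq (continuous_star.mul continuous_id) continuous_const).inter
      (isClosed_eq (continuous_id.mul continuous_star) continuous_const)
  refine isCompact_iff_compactSpace.mp (hb.of_isClosed_subset hc ?_)
  intro A hA i _ j _
  simpa using entry_norm_bound_of_unitary (U := A) hA i j

/-- The Haar probability measure on `2^N × 2^N` unitaries. -/
def haarUnitary (N : ℕ) : Measure (Matrix.unitaryGroup (Reg N) ℂ) :=
  Measure.haarMeasure ⊤

/-- The distribution of an `N`-qubit Haar state: `U|0^N⟩` for a Haar unitary `U`. -/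
def haarState (N : ℕ) : Measure (Reg N → ℂ) :=
  (haarUnitary N).map fun (U : Matrix.unitaryGroup (Reg N) ℂ) a => U.1 a (zeros N)

instance instProbHaarUnitary (N : ℕ) : IsProbabilityMeasure (haarUnitary N) :=
  ⟨Measure.haarMeasure_self
    (K₀ := (⊤ : TopologicalSpace.PositiveCompacts (Matrix.unitaryGroup (Reg N) ℂ)))⟩

instance instProbHaarState (N : ℕ) : IsProbabilityMeasure (haarState N) := by
  refine Measure.isProbabilityMeasure_map (Continuous.aemeasurable ?_)
  exact continuous_pi fun a =>
    (continuous_apply (zeros N)).comp ((continuous_apply a).comp continuous_subtype_val)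

/-- The isometry `|ψ⟩ ↦ U (|ψ⟩ ⊗ |0^m⟩)`; it is a Haar isometry when `U` is a Haar unitary. -/
def isometryOf {n m : ℕ} (U : Matrix.unitaryGroup (Reg (n + m)) ℂ) :
    Matrix (Reg (n + m)) (Reg n) ℂ :=
  fun y x => U.1 y (Fin.append x (zeros m))

/-- The channel `ρ ↦ V ρ V†`. -/
def conj {n p : ℕ} (V : Matrix (Reg p) (Reg n) ℂ) (ρ : Op n) : Op p := V * ρ * V.conjTranspose

/-! ## Pseudorandom isometries -/

/-- The computational basis queries `𝒟(ℂ^{2^ℓ}) ⊗ {|x₁⟩⟨x₁| ⊗ ⋯ ⊗ |x_q⟩⟨x_q|}`. -/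
def QComp (n q ℓ : ℕ) : Set (Op (ℓ + q * n)) :=
  {ρ | ∃ τ : Op ℓ, IsDensity τ ∧ ∃ x : Fin q → Reg n, ρ = tensor τ (tensorAll fun i => basisOp (x i))}

/-- The map `F_κ(k, ·)` of a circuit family that takes a `κ`-bit key and an `n`-qubit state. -/
def keyed {𝒢 : GateSet} {κ n p : ℕ} (F : Circuit 𝒢 (κ + n) p) (k : Reg κ) (ρ : Op n) : Op p :=
  F.run (tensor (basisOp k) ρ)

/-- Security against the queries `𝒬`: no polynomial-size distinguisher tells `q` parallel uses of
`F_κ(k, ·)` for a random key from `q` parallel uses of one Haar isometry, on any query in `𝒬 κ`. -/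
def IsSecureOn {𝒢 : GateSet} (n m q ℓ : ℕ → ℕ)
    (𝒬 : (κ : ℕ) → Set (Op (ℓ κ + q κ * n κ)))
    (F : (κ : ℕ) → Circuit 𝒢 (κ + n κ) (n κ + m κ)) : Prop :=
  ∀ D : (κ : ℕ) → Circuit 𝒢 (ℓ κ + q κ * (n κ + m κ)) 1, IsPolySize D →
    ∃ ε : ℕ → ℝ, Negligible ε ∧ ∀ᶠ κ in atTop, ∀ ρ ∈ 𝒬 κ,
      |keyAvg (fun k : Reg κ => (D κ).accept (parallel (keyed (F κ) k) ρ)) -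
        ∫ U, (D κ).accept (parallel (conj (isometryOf U)) ρ) ∂haarUnitary (n κ + m κ)| ≤ ε κ

/-- `Q_Comp`-secure `(n, n+m)`-pseudorandom isometries. -/
structure IsQCompPRI {𝒢 : GateSet} (n m : ℕ → ℕ)
    (F : (κ : ℕ) → Circuit 𝒢 (κ + n κ) (n κ + m κ)) : Prop where
  qpt : IsQPT F
  isometric : ∀ κ (k : Reg κ), ∃ V : Matrix (Reg (n κ + m κ)) (Reg (n κ)) ℂ,
    V.conjTranspose * V = 1 ∧ ∀ ρ, keyed (F κ) k ρ = conj V ρ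
  secure : ∀ q ℓ : ℕ → ℕ, PolyBounded q → PolyBounded ℓ →
    IsSecureOn n m q ℓ (fun κ => QComp (n κ) (q κ) (ℓ κ)) F

/-! ## Pseudorandom state generators -/

/-- `N`-qubit pseudorandom state generators. Distinguishers are non-uniform: polynomial-size
circuits `D` with `a κ`-qubit quantum advice `adv`. -/
structure IsPRSG {𝒢 : GateSet} (N : ℕ → ℕ) (G : (κ : ℕ) → Circuit 𝒢 κ (N κ)) : Prop where
  qpt : IsQPT G
  pseudorandom : ∀ t a : ℕ → ℕ, PolyBounded t → PolyBounded a →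
    ∀ adv : (κ : ℕ) → Op (a κ), (∀ κ, IsDensity (adv κ)) →
    ∀ D : (κ : ℕ) → Circuit 𝒢 (a κ + t κ * N κ) 1, IsPolySize D →
    ∃ ε : ℕ → ℝ, Negligible ε ∧ ∀ κ,
      |keyAvg (fun k : Reg κ => (D κ).accept
          (tensor (adv κ) (tensorAll fun _ : Fin (t κ) => (G κ).run (basisOp k)))) -
        ∫ ϑ, (D κ).accept
          (tensor (adv κ) (tensorAll fun _ : Fin (t κ) => pureOp ϑ)) ∂haarState (N κ)| ≤ ε κ

/-- The input of a distinguisher in the selective security game for generators of function-like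
states: advice, the indices `x₁, …, x_s`, and `t` copies of each of the states `σ₁, …, σ_s`. -/
def prfsView {a s d t N : ℕ} (adv : Op a) (x : Fin s → Reg d) (σ : Fin s → Op N) :
    Op (a + s * d + s * t * N) :=
  tensor (tensor adv (tensorAll fun i => basisOp (x i)))
    (tensorAll fun c : Fin (s * t) => σ c.divNat)

/-- Selectively secure `(d, N)`-pseudorandom function-like state generators: for every set of
distinct indices, the generated states are indistinguishable from independent Haar states.
Distinguishers are non-uniform. -/
structure IsPRFSG {𝒢 : GateSet} (d N : ℕ → ℕ)
    (G : (κ : ℕ) → Circuit 𝒢 (κ + d κ) (N κ)) : Prop where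
  qpt : IsQPT G
  pseudorandom : ∀ s t a : ℕ → ℕ, PolyBounded s → PolyBounded t → PolyBounded a →
    ∀ adv : (κ : ℕ) → Op (a κ), (∀ κ, IsDensity (adv κ)) →
    ∀ x : (κ : ℕ) → Fin (s κ) → Reg (d κ), (∀ κ, Function.Injective (x κ)) →
    ∀ D : (κ : ℕ) → Circuit 𝒢 (a κ + s κ * d κ + s κ * t κ * N κ) 1, IsPolySize D →
    ∃ ε : ℕ → ℝ, Negligible ε ∧ ∀ κ,
      |keyAvg (fun k : Reg κ => (D κ).accept
          (prfsView (t := t κ) (adv κ) (x κ) fun i => keyed (G κ) k (basisOp (x κ i)))) -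
        ∫ ϑ : Fin (s κ) → Reg (N κ) → ℂ, (D κ).accept
          (prfsView (t := t κ) (adv κ) (x κ) fun i => pureOp (ϑ i))
          ∂Measure.pi fun _ => haarState (N κ)| ≤ ε κ

end QCrypto

end

/-!
A circuit family for `F` with its `n` data wires turned into ancilla wires computes
`k ↦ F_k(|0^n⟩⟨0^n|)` and has the same description, so it is again a QPT algorithm. A Haar isometry
maps a computational basis state `|x⟩` to the column `U|x, 0^m⟩` of a Haar unitary, and parallel
queries `|x₁⟩, …, |x_q⟩` next to side information `τ` return `τ ⊗ ⨂ F_k|x_i⟩`. Both security games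
are therefore instances of the one for isometries, with the same distinguisher: `t` queries `0^n`
next to the advice give the first game exactly, because one column of a Haar unitary is a Haar
state. In the second game each `x_i` is queried `t` times, with the advice and the indices as side
information (`IsQCompPRI.negligible_advantage`), and what remains is that the columns
`U|x_i, 0^m⟩` of one Haar unitary are close to independent Haar states `ϑ_i`
(`abs_integral_columns_sub_integral_haarStates_le`).

For this, rotate the independent states `ϑ_i` by one more Haar unitary `V`, which does not change
their joint law. For fixed `ϑ`, polar decomposition of the matrix with columns `ϑ_i` gives an
orthonormal family at Hilbert–Schmidt distance at most `‖G - 1‖`, where `G` is the Gram matrix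
(`exists_orthonormalBasis_near`). By right invariance its rotation by `V` is distributed as `s`
columns of a Haar unitary. An acceptance probability is a positive functional that is bounded by the
trace, which makes it continuous in the tensor factors (`abs_acceptCopies_sub_le`), and the expected
value of `‖G - 1‖²` is at most `s² / 2^N` with `N = n + m`, because two independent Haar states have
expected squared overlap `2^(-N)` (`integral_normSq_overlap`). The total error is polynomial in `s`
and `t` times `2^(-N/4)`, hence negligible.
-/

noncomputable section

namespace QCrypto

open MeasureTheory Filter
open scoped ComplexOrder

/-! ### Acceptance probabilities of circuits -/

/-- Summing a function of the values on the wires `p` over all strings with prescribed values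
elsewhere. -/
lemma sum_ite_eq_off_range {r w : ℕ} (p : Fin r ↪ Fin w) (x : Reg w) (h : Reg r → ℂ)
    [∀ y : Reg w, Decidable (∀ i, i ∉ Set.range p → y i = x i)] :
    (∑ y : Reg w, if ∀ i, i ∉ Set.range p → y i = x i then h (fun j => y (p j)) else 0) =
      ∑ u, h u := by
  rw [← Finset.sum_filter]
  refine Finset.sum_nbij' (fun y j => y (p j)) (fun u => Function.extend p u x) ?_ ?_ ?_ ?_ ?_
  · simp
  · intro u _
    simp only [Finset.mem_filter, Finset.mem_univ, true_and]
    intro i hi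
    exact Function.extend_apply' _ _ _ hi
  · intro y hy
    simp only [Finset.mem_filter, Finset.mem_univ, true_and] at hy
    funext i
    by_cases hi : i ∈ Set.range p
    · obtain ⟨j, rfl⟩ := hi
      exact p.injective.extend_apply _ _ _
    · rw [hy i hi]
      exact Function.extend_apply' _ _ _ hi
  · intro u _
    funext j
    exact p.injective.extend_apply _ _ _
  · simp

lemma Gate.op_of_eq_off_range {𝒢 : GateSet} {w : ℕ} (g : Gate 𝒢 w) {x y : Reg w}
    (h : ∀ i, i ∉ Set.range g.pos → x i = y i) :
    g.op x y = (𝒢.mat g.idx).1 (fun j => x (g.pos j)) (fun j => y (g.pos j)) := by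
  classical
  exact if_pos h

lemma Gate.op_of_ne_off_range {𝒢 : GateSet} {w : ℕ} (g : Gate 𝒢 w) {x y : Reg w}
    (h : ¬ ∀ i, i ∉ Set.range g.pos → x i = y i) : g.op x y = 0 := by
  classical
  exact if_neg h

lemma Gate.conjTranspose_op_mul_op {𝒢 : GateSet} {w : ℕ} (g : Gate 𝒢 w) :
    g.op.conjTranspose * g.op = 1 := by
  classical
  obtain ⟨M, hMdef⟩ : ∃ M : Op (𝒢.arity g.idx), M = (𝒢.mat g.idx).1 := ⟨_, rfl⟩
  have hM : M.conjTranspose * M = 1 := by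
    rw [hMdef]
    exact Matrix.mem_unitaryGroup_iff'.mp (𝒢.mat g.idx).2
  have hop : ∀ {x y : Reg w}, (∀ i, i ∉ Set.range g.pos → x i = y i) →
      g.op x y = M (fun j => x (g.pos j)) (fun j => y (g.pos j)) := by
    intro x y h
    rw [hMdef]
    exact g.op_of_eq_off_range h
  ext x z
  rw [Matrix.mul_apply]
  by_cases hxz : ∀ i, i ∉ Set.range g.pos → x i = z i
  · obtain ⟨h, hh⟩ : ∃ h : Reg (𝒢.arity g.idx) → ℂ, ∀ u, h u =
        star (M u (fun j => x (g.pos j))) * M u (fun j => z (g.pos j)) := ⟨_, fun _ => rfl⟩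
    have key : ∀ y : Reg w, g.op.conjTranspose x y * g.op y z =
        if ∀ i, i ∉ Set.range g.pos → y i = x i then h (fun j => y (g.pos j)) else 0 := by
      intro y
      by_cases hy : ∀ i, i ∉ Set.range g.pos → y i = x i
      · rw [if_pos hy, Matrix.conjTranspose_apply, hop hy,
          hop fun i hi => (hy i hi).trans (hxz i hi), hh]
      · rw [if_neg hy, Matrix.conjTranspose_apply, g.op_of_ne_off_range hy, star_zero, zero_mul]
    rw [Finset.sum_congr rfl fun y _ => key y, sum_ite_eq_off_range g.pos x h,
      Finset.sum_congr rfl fun u _ => hh u]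
    have := congrFun (congrFun hM fun j => x (g.pos j)) fun j => z (g.pos j)
    rw [Matrix.mul_apply] at this
    refine this.trans ?_
    rw [Matrix.one_apply, Matrix.one_apply]
    refine if_congr ⟨fun h => ?_, fun h => by rw [h]⟩ rfl rfl
    funext i
    by_cases hi : i ∈ Set.range g.pos
    · obtain ⟨j, rfl⟩ := hi
      exact congrFun h j
    · exact hxz i hi
  · have hne : x ≠ z := fun h => hxz fun i _ => congrFun h i
    rw [Matrix.one_apply_ne hne]
    refine Finset.sum_eq_zero fun y _ => ?_
    by_cases hy : ∀ i, i ∉ Set.range g.pos → y i = x i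
    · have hyz : ¬ ∀ i, i ∉ Set.range g.pos → y i = z i :=
        fun h => hxz fun i hi => (hy i hi).symm.trans (h i hi)
      rw [g.op_of_ne_off_range hyz, mul_zero]
    · rw [Matrix.conjTranspose_apply, g.op_of_ne_off_range hy, star_zero, zero_mul]

namespace Circuit

variable {𝒢 : GateSet} {inp out : ℕ}

lemma conjTranspose_unitary_mul_unitary (C : Circuit 𝒢 inp out) :
    C.unitary.conjTranspose * C.unitary = 1 := by
  have aux : ∀ (l : List (Gate 𝒢 C.wires)) (U : Op C.wires), U.conjTranspose * U = 1 →
      (l.foldl (fun U g => g.op * U) U).conjTranspose * l.foldl (fun U g => g.op * U) U = 1 := by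
    intro l
    induction l with
    | nil => exact fun U hU => hU
    | cons g l ih =>
      intro U hU
      refine ih _ ?_
      rw [Matrix.conjTranspose_mul, Matrix.mul_assoc, ← Matrix.mul_assoc _ g.op U,
        g.conjTranspose_op_mul_op, Matrix.one_mul, hU]
  exact aux _ _ (by simp)

/-- An input string, followed by zeros on the ancilla wires. -/
def pad (C : Circuit 𝒢 inp out) (u : Reg inp) : Reg C.wires :=
  fun i => if h : i.val < inp then u ⟨i, h⟩ else false

/-- The isometry that adjoins the ancilla wires, in the state zero, to the input. -/
def inject (C : Circuit 𝒢 inp out) : Matrix (Reg C.wires) (Reg inp) ℂ :=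
  fun x u => if x = C.pad u then 1 else 0

lemma eq_pad_iff (C : Circuit 𝒢 inp out) (x : Reg C.wires) (u : Reg inp) :
    x = C.pad u ↔
      (∀ i : Fin C.wires, inp ≤ i.val → x i = false) ∧ (fun j => x (Fin.castLE C.le j)) = u := by
  constructor
  · rintro rfl
    refine ⟨fun i hi => ?_, ?_⟩
    · simp [pad, hi]
    · funext j
      simp [pad]
  · rintro ⟨h, rfl⟩
    funext i
    by_cases hi : i.val < inp
    · simp only [pad, hi, dite_true]
      rfl
    · simp [pad, hi, h i (not_lt.mp hi)]

lemma conjTranspose_inject_mul_inject (C : Circuit 𝒢 inp out) :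
    C.inject.conjTranspose * C.inject = 1 := by
  have hinj : Function.Injective C.pad := fun u v huv =>
    (((C.eq_pad_iff _ u).mp rfl).2).symm.trans ((C.eq_pad_iff _ v).mp huv).2
  ext u v
  simp [Matrix.mul_apply, inject, Matrix.one_apply, apply_ite, hinj.eq_iff, eq_comm]

lemma initial_eq (C : Circuit 𝒢 inp out) (ρ : Op inp) :
    C.initial ρ = C.inject * ρ * C.inject.conjTranspose := by
  classical
  ext x y
  simp only [Matrix.mul_apply, inject, Matrix.conjTranspose_apply, eq_pad_iff, initial]
  by_cases hx : ∀ i : Fin C.wires, inp ≤ i.val → x i = false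
  · by_cases hy : ∀ i : Fin C.wires, inp ≤ i.val → y i = false
    · rw [if_pos fun i hi => ⟨hx i hi, hy i hi⟩]
      simp only [eq_true hx, eq_true hy, true_and, ite_mul, one_mul, zero_mul, Finset.sum_ite_eq,
        Finset.mem_univ, if_true, apply_ite (star : ℂ → ℂ), star_one, star_zero, mul_ite, mul_one,
        mul_zero]
    · rw [if_neg fun h => hy fun i hi => (h i hi).2]
      simp [hy]
  · rw [if_neg fun h => hx fun i hi => (h i hi).1]
    simp [hx]

/-- The isometry carried out by a circuit before the non-output wires are traced out. -/
def isometry (C : Circuit 𝒢 inp out) : Matrix (Reg C.wires) (Reg inp) ℂ := C.unitary * C.inject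

lemma conjTranspose_isometry_mul_isometry (C : Circuit 𝒢 inp out) :
    C.isometry.conjTranspose * C.isometry = 1 := by
  rw [isometry, Matrix.conjTranspose_mul, Matrix.mul_assoc, ← Matrix.mul_assoc _ C.unitary,
    conjTranspose_unitary_mul_unitary, Matrix.one_mul, conjTranspose_inject_mul_inject]

lemma accept_eq (D : Circuit 𝒢 inp 1) (ρ : Op inp) :
    D.accept ρ = ∑ x : Reg D.wires with x (D.output 0) = true,
      ((D.isometry * ρ * D.isometry.conjTranspose) x x).re := by
  classical
  have hσ : D.unitary * D.initial ρ * D.unitary.conjTranspose =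
      D.isometry * ρ * D.isometry.conjTranspose := by
    rw [initial_eq, isometry, Matrix.conjTranspose_mul]
    simp only [Matrix.mul_assoc]
  rw [accept, run, hσ, traceOut, Finset.sum_filter, Complex.re_sum]
  refine Finset.sum_congr rfl fun x _ => ?_
  by_cases hx : x (D.output 0) = true
  · rw [if_pos hx, Finset.sum_eq_single x, if_pos]
    · exact ⟨fun j => by rw [Subsingleton.elim j 0, hx], fun j => by rw [Subsingleton.elim j 0, hx],
        fun _ _ => rfl⟩
    · intro y _ hyx
      refine if_neg fun h => hyx ?_
      funext i
      by_cases hi : i ∈ Set.range D.output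
      · obtain ⟨j, rfl⟩ := hi
        rw [h.1 j, h.2.1 j]
      · exact (h.2.2 i hi).symm
    · simp
  · rw [if_neg hx, Finset.sum_eq_zero, Complex.zero_re]
    intro y _
    exact if_neg fun h => hx (h.1 0)

/-- The acceptance probability as a real-linear function of the input operator. -/
def acceptL (D : Circuit 𝒢 inp 1) : Op inp →ₗ[ℝ] ℝ where
  toFun := D.accept
  map_add' ρ σ := by
    simp [accept_eq, Matrix.mul_add, Matrix.add_mul, Finset.sum_add_distrib]
  map_smul' c ρ := by
    simp [accept_eq, Finset.mul_sum]

lemma continuous_accept (D : Circuit 𝒢 inp 1) : Continuous D.accept :=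
  LinearMap.continuous_of_finiteDimensional D.acceptL

lemma accept_nonneg (D : Circuit 𝒢 inp 1) {ρ : Op inp} (hρ : ρ.PosSemidef) : 0 ≤ D.accept ρ := by
  rw [accept_eq]
  exact Finset.sum_nonneg fun x _ =>
    (Complex.nonneg_iff.mp (hρ.mul_mul_conjTranspose_same D.isometry).diag_nonneg).1

lemma accept_le_trace (D : Circuit 𝒢 inp 1) {ρ : Op inp} (hρ : ρ.PosSemidef) :
    D.accept ρ ≤ ρ.trace.re := by
  have htr : (D.isometry * ρ * D.isometry.conjTranspose).trace = ρ.trace := by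
    rw [Matrix.trace_mul_comm, ← Matrix.mul_assoc, conjTranspose_isometry_mul_isometry,
      Matrix.one_mul]
  rw [accept_eq, ← htr, Matrix.trace, Complex.re_sum]
  exact Finset.sum_le_sum_of_subset_of_nonneg (Finset.filter_subset _ _) fun x _ _ =>
    (Complex.nonneg_iff.mp (hρ.mul_mul_conjTranspose_same D.isometry).diag_nonneg).1

end Circuit

/-! ### Tensor products of operators and vectors -/

@[simp] lemma fstPart_append {a b : ℕ} (u : Reg a) (v : Reg b) : fstPart (Fin.append u v) = u := by
  funext i
  simp [fstPart]

@[simp] lemma sndPart_append {a b : ℕ} (u : Reg a) (v : Reg b) : sndPart (Fin.append u v) = v := by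
  funext i
  simp [sndPart]

lemma append_fstPart_sndPart {a b : ℕ} (x : Reg (a + b)) :
    Fin.append (fstPart x) (sndPart x) = x := by
  funext i
  refine Fin.addCases (fun i => ?_) (fun i => ?_) i <;> simp [fstPart, sndPart]

/-- A string of `a + b` bits as a pair of strings. -/
def splitEquiv (a b : ℕ) : Reg (a + b) ≃ Reg a × Reg b where
  toFun x := (fstPart x, sndPart x)
  invFun p := Fin.append p.1 p.2
  left_inv := append_fstPart_sndPart
  right_inv p := by simp

/-- A string of `q * n` bits as a tuple of its blocks. -/
def blockEquiv (q n : ℕ) : Reg (q * n) ≃ (Fin q → Reg n) where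
  toFun x := block x
  invFun u c := u (finProdFinEquiv.symm c).1 (finProdFinEquiv.symm c).2
  left_inv x := by
    funext c
    simp only [block, Prod.mk.eta, Equiv.apply_symm_apply]
  right_inv u := by
    funext i j
    simp only [block, Equiv.symm_apply_apply]

lemma tensor_eq_submatrix {a b : ℕ} (ρ : Op a) (σ : Op b) :
    tensor ρ σ = (Matrix.kroneckerMap (· * ·) ρ σ).submatrix (splitEquiv a b) (splitEquiv a b) :=
  rfl

lemma posSemidef_tensor {a b : ℕ} {ρ : Op a} {σ : Op b} (hρ : ρ.PosSemidef) (hσ : σ.PosSemidef) :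
    (tensor ρ σ).PosSemidef := by
  rw [tensor_eq_submatrix]
  exact (hρ.kronecker hσ).submatrix _

lemma trace_tensor {a b : ℕ} (ρ : Op a) (σ : Op b) :
    (tensor ρ σ).trace = ρ.trace * σ.trace := by
  rw [← Matrix.trace_kronecker]
  exact (splitEquiv a b).sum_comp fun p => Matrix.kroneckerMap (· * ·) ρ σ p p

lemma IsDensity.tensor {a b : ℕ} {ρ : Op a} {σ : Op b} (hρ : IsDensity ρ) (hσ : IsDensity σ) :
    IsDensity (tensor ρ σ) :=
  ⟨posSemidef_tensor hρ.1 hσ.1, by rw [trace_tensor, hρ.2, hσ.2, one_mul]⟩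

lemma basisOp_apply {n : ℕ} (x y z : Reg n) :
    basisOp x y z = (if y = x then 1 else 0) * if z = x then 1 else 0 := by
  by_cases hy : y = x <;> by_cases hz : z = x <;>
    simp [basisOp, hy, hz, eq_comm (a := x)]

lemma basisOp_eq_pureOp {n : ℕ} (x : Reg n) : basisOp x = pureOp (Pi.single x 1) := by
  ext y z
  rw [basisOp_apply, pureOp, Matrix.vecMulVec_apply]
  by_cases hy : y = x <;> by_cases hz : z = x <;> simp [hy, hz]

lemma posSemidef_pureOp {n : ℕ} (v : Reg n → ℂ) : (pureOp v).PosSemidef :=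
  Matrix.posSemidef_vecMulVec_self_star v

lemma trace_pureOp {n : ℕ} (v : Reg n → ℂ) : (pureOp v).trace = star v ⬝ᵥ v := by
  rw [pureOp, Matrix.trace_vecMulVec, dotProduct_comm]

lemma isDensity_basisOp {n : ℕ} (x : Reg n) : IsDensity (basisOp x) := by
  rw [basisOp_eq_pureOp]
  exact ⟨posSemidef_pureOp _, by rw [trace_pureOp]; simp⟩

lemma tensorAll_basisOp {q n : ℕ} (x : Fin q → Reg n) :
    tensorAll (fun i => basisOp (x i)) = basisOp ((blockEquiv q n).symm x) := by
  ext u v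
  have h : ∀ u : Reg (q * n), u = (blockEquiv q n).symm x ↔ ∀ i, block u i = x i := by
    intro u
    rw [Equiv.eq_symm_apply]
    exact funext_iff
  rw [tensorAll, basisOp_apply, if_congr (h u) rfl rfl, if_congr (h v) rfl rfl]
  simp only [basisOp_apply, Finset.prod_mul_distrib, Finset.prod_ite_zero, Finset.prod_const_one,
    Finset.mem_univ, true_implies]

/-- The vector `v 0 ⊗ v 1 ⊗ ⋯ ⊗ v (q-1)`. -/
def tensorVec {q n : ℕ} (v : Fin q → Reg n → ℂ) : Reg (q * n) → ℂ := fun x => ∏ i, v i (block x i)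

lemma tensorAll_pureOp {q n : ℕ} (v : Fin q → Reg n → ℂ) :
    tensorAll (fun i => pureOp (v i)) = pureOp (tensorVec v) := by
  ext x y
  simp [tensorAll, pureOp, Matrix.vecMulVec_apply, tensorVec, Finset.prod_mul_distrib]

lemma star_tensorVec_dotProduct {q n : ℕ} (v w : Fin q → Reg n → ℂ) :
    star (tensorVec v) ⬝ᵥ tensorVec w = ∏ i, star (v i) ⬝ᵥ w i := by
  simp only [dotProduct]
  rw [Finset.prod_univ_sum, Fintype.piFinset_univ, ← (blockEquiv q n).sum_comp]
  refine Finset.sum_congr rfl fun x _ => ?_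
  simp [tensorVec, blockEquiv, Finset.prod_mul_distrib]

/-- Parallel uses of a map on a computational basis query. -/
lemma parallel_tensor_basisOp {ℓ q n p : ℕ} (Φ : Op n → Op p) (τ : Op ℓ) (x : Fin q → Reg n) :
    parallel Φ (tensor τ (tensorAll fun i => basisOp (x i))) =
      tensor τ (tensorAll fun i => Φ (basisOp (x i))) := by
  ext y z
  simp only [parallel, tensorAll_basisOp, tensor, fstPart_append, sndPart_append, basisOp_apply]
  rw [Finset.sum_eq_single ((blockEquiv q n).symm x), Finset.sum_eq_single ((blockEquiv q n).symm x)]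
  · have hx : ∀ i, block ((blockEquiv q n).symm x) i = x i :=
      congrFun ((blockEquiv q n).apply_symm_apply x)
    simp [hx, tensorAll, basisOp]
  · intro v _ hv
    simp [hv]
  · simp
  · intro u _ hu
    simp [hu]
  · simp

lemma conj_isometryOf_basisOp {n m : ℕ} (U : Matrix.unitaryGroup (Reg (n + m)) ℂ) (x : Reg n) :
    conj (isometryOf U) (basisOp x) = pureOp fun y => U.1 y (Fin.append x (zeros m)) := by
  ext y z
  simp only [conj, Matrix.mul_apply, basisOp_apply, isometryOf, pureOp, Matrix.vecMulVec_apply,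
    Matrix.conjTranspose_apply]
  simp

/-! ### Continuity of acceptance probabilities in the tensor factors -/

lemma star_dotProduct_comm_re {n : ℕ} (v w : Reg n → ℂ) :
    (star v ⬝ᵥ w).re = (star w ⬝ᵥ v).re := by
  rw [← Complex.conj_re, starRingEnd_apply, Matrix.star_dotProduct, star_star]

/-- Positivity alone makes `ψ ↦ Pr[D(τ ⊗ |ψ⟩⟨ψ|) = 1]` continuous on unit vectors: by
polarization, a multiple of the difference of two values is the difference of the values at
`(1 ± r) ψ + (1 ∓ r) φ`, and both of these lie between zero and the squared norm. -/
lemma abs_accept_tensor_pureOp_sub_le {𝒢 : GateSet} {a b : ℕ} (D : Circuit 𝒢 (a + b) 1) {τ : Op a}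
    (hτ : IsDensity τ) {ψ φ : Reg b → ℂ} (hψ : star ψ ⬝ᵥ ψ = 1) (hφ : star φ ⬝ᵥ φ = 1)
    {η : ℝ} (hη : 0 < η) :
    |D.accept (tensor τ (pureOp ψ)) - D.accept (tensor τ (pureOp φ))| ≤
      η + (1 - (star ψ ⬝ᵥ φ).re) / (2 * η) := by
  have hA : ∀ v : Reg b → ℂ, 0 ≤ D.accept (tensor τ (pureOp v)) ∧
      D.accept (tensor τ (pureOp v)) ≤ (star v ⬝ᵥ v).re := by
    intro v
    have h := posSemidef_tensor hτ.1 (posSemidef_pureOp v)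
    refine ⟨D.accept_nonneg h, (D.accept_le_trace h).trans_eq ?_⟩
    rw [trace_tensor, hτ.2, one_mul, trace_pureOp]
  have hcomb : ∀ s t : ℝ, (star ((s : ℂ) • ψ + (t : ℂ) • φ) ⬝ᵥ ((s : ℂ) • ψ + (t : ℂ) • φ)).re =
      s ^ 2 + t ^ 2 + 2 * s * t * (star ψ ⬝ᵥ φ).re := by
    intro s t
    have h : star ((s : ℂ) • ψ + (t : ℂ) • φ) ⬝ᵥ ((s : ℂ) • ψ + (t : ℂ) • φ) =
        (s ^ 2 : ℝ) + (t ^ 2 : ℝ) + (s * t : ℝ) * (star ψ ⬝ᵥ φ) + (s * t : ℝ) * (star φ ⬝ᵥ ψ) := by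
      simp only [star_add, star_smul, add_dotProduct, dotProduct_add, smul_dotProduct,
        dotProduct_smul, hψ, hφ, Complex.star_def, Complex.conj_ofReal, smul_eq_mul]
      push_cast
      ring
    rw [h]
    simp only [Complex.add_re, Complex.ofReal_re, Complex.re_ofReal_mul, star_dotProduct_comm_re φ ψ]
    ring
  have hc : (star ψ ⬝ᵥ φ).re ≤ 1 := by
    have h1 := hcomb 1 (-1)
    have h2 := hA (((1 : ℝ) : ℂ) • ψ + ((-1 : ℝ) : ℂ) • φ)
    linarith [h2.1.trans h2.2]
  obtain ⟨r, hr⟩ : ∃ r : ℝ, r = 1 / η := ⟨_, rfl⟩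
  have hrpos : 0 < r := by rw [hr]; positivity
  have hpol : D.accept (tensor τ (pureOp (((1 + r : ℝ) : ℂ) • ψ + ((1 - r : ℝ) : ℂ) • φ))) =
      D.accept (tensor τ (pureOp (((1 - r : ℝ) : ℂ) • ψ + ((1 + r : ℝ) : ℂ) • φ))) +
        4 * r * (D.accept (tensor τ (pureOp ψ)) - D.accept (tensor τ (pureOp φ))) := by
    have h : tensor τ (pureOp (((1 + r : ℝ) : ℂ) • ψ + ((1 - r : ℝ) : ℂ) • φ)) =
        tensor τ (pureOp (((1 - r : ℝ) : ℂ) • ψ + ((1 + r : ℝ) : ℂ) • φ)) +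
          (4 * r : ℝ) • (tensor τ (pureOp ψ) - tensor τ (pureOp φ)) := by
      ext x y
      simp only [tensor, pureOp, Matrix.vecMulVec_apply, Matrix.add_apply, Matrix.sub_apply,
        Matrix.smul_apply, Pi.add_apply, Pi.star_apply, Pi.smul_apply, star_add, star_smul,
        Complex.star_def, Complex.conj_ofReal, smul_eq_mul, Complex.real_smul]
      push_cast
      ring
    have h' := congrArg D.acceptL h
    rwa [map_add, map_smul, map_sub, smul_eq_mul] at h'
  have h1 := hA (((1 + r : ℝ) : ℂ) • ψ + ((1 - r : ℝ) : ℂ) • φ)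
  have h2 := hA (((1 - r : ℝ) : ℂ) • ψ + ((1 + r : ℝ) : ℂ) • φ)
  rw [hcomb] at h1 h2
  obtain ⟨c, hcdef⟩ : ∃ c, c = (star ψ ⬝ᵥ φ).re := ⟨_, rfl⟩
  rw [← hcdef] at h1 h2 hc ⊢
  -- both squared norms equal `2 + 2 c + 2 r² (1 - c)`, and `c ≤ 1`
  have hb : η + (1 - c) / (2 * η) = (4 + 2 * r ^ 2 * (1 - c)) / (4 * r) := by
    rw [hr]
    field_simp
    ring
  rw [hb, le_div_iff₀ (by positivity), ← abs_of_pos (show 0 < 4 * r by positivity), ← abs_mul,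
    abs_le]
  constructor <;> nlinarith [h1.1, h1.2, h2.1, h2.2]

lemma norm_one_sub_prod_le {ι : Type*} (s : Finset ι) (a : ι → ℂ) (ha : ∀ i ∈ s, ‖a i‖ ≤ 1) :
    ‖1 - ∏ i ∈ s, a i‖ ≤ ∑ i ∈ s, ‖1 - a i‖ := by
  classical
  induction s using Finset.induction_on with
  | empty => simp
  | insert i s hi ih =>
    rw [Finset.prod_insert hi, Finset.sum_insert hi]
    have h : 1 - a i * ∏ j ∈ s, a j = (1 - a i) + a i * (1 - ∏ j ∈ s, a j) := by ring
    rw [h]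
    refine (norm_add_le _ _).trans (add_le_add le_rfl ?_)
    rw [norm_mul]
    exact (mul_le_of_le_one_left (norm_nonneg _) (ha i (Finset.mem_insert_self i s))).trans
      (ih fun j hj => ha j (Finset.mem_insert_of_mem hj))

lemma norm_star_dotProduct_le {n : ℕ} (v w : Reg n → ℂ) :
    ‖star v ⬝ᵥ w‖ ≤ ‖WithLp.toLp 2 v‖ * ‖WithLp.toLp 2 w‖ := by
  have h := norm_inner_le_norm (𝕜 := ℂ) (WithLp.toLp 2 v) (WithLp.toLp 2 w)
  rwa [EuclideanSpace.inner_eq_star_dotProduct, dotProduct_comm] at h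

lemma norm_toLp_of_star_dotProduct_self {n : ℕ} {v : Reg n → ℂ} (hv : star v ⬝ᵥ v = 1) :
    ‖WithLp.toLp 2 v‖ = 1 := by
  have h := inner_self_eq_norm_sq_to_K (𝕜 := ℂ) (WithLp.toLp 2 v)
  rw [EuclideanSpace.inner_eq_star_dotProduct, dotProduct_comm] at h
  have h2 : ((‖WithLp.toLp 2 v‖ ^ 2 : ℝ) : ℂ) = (1 : ℝ) := by
    rw [Complex.ofReal_pow, Complex.ofReal_one, ← hv]
    exact h.symm
  have h3 := Complex.ofReal_injective h2
  nlinarith [norm_nonneg (WithLp.toLp 2 v)]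

lemma sum_divNat {s t : ℕ} (g : Fin s → ℝ) :
    ∑ c : Fin (s * t), g c.divNat = t * ∑ i, g i := by
  rw [← finProdFinEquiv.sum_comp, Fintype.sum_prod_type, Finset.mul_sum]
  refine Finset.sum_congr rfl fun i _ => ?_
  have h : ∀ j : Fin t, (finProdFinEquiv (i, j)).divNat = i := fun j =>
    congrArg Prod.fst (finProdFinEquiv.symm_apply_apply (i, j))
  simp [h]

/-- The acceptance probability on a state `τ` and `t` copies of each of `s` pure states. -/
def acceptCopies {𝒢 : GateSet} {a s t N : ℕ} (D : Circuit 𝒢 (a + s * t * N) 1) (τ : Op a)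
    (z : Fin s → Reg N → ℂ) : ℝ :=
  D.accept (tensor τ (tensorAll fun c : Fin (s * t) => pureOp (z c.divNat)))

/-- Replacing `t` copies of each of `s` unit vectors by nearby unit vectors changes an acceptance
probability by little. -/
lemma abs_acceptCopies_sub_le {𝒢 : GateSet} {a s t N : ℕ}
    (D : Circuit 𝒢 (a + s * t * N) 1) {τ : Op a} (hτ : IsDensity τ) {z w : Fin s → Reg N → ℂ}
    (hz : ∀ i, star (z i) ⬝ᵥ z i = 1) (hw : ∀ i, star (w i) ⬝ᵥ w i = 1) {η : ℝ} (hη : 0 < η) :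
    |acceptCopies D τ z - acceptCopies D τ w| ≤
      η * (1 + s * t) + t / (8 * η ^ 3) * ∑ i, ‖WithLp.toLp 2 (z i - w i)‖ ^ 2 := by
  rw [acceptCopies, acceptCopies, tensorAll_pureOp, tensorAll_pureOp]
  refine (abs_accept_tensor_pureOp_sub_le D hτ (by simp [star_tensorVec_dotProduct, hz])
    (by simp [star_tensorVec_dotProduct, hw]) hη).trans ?_
  rw [star_tensorVec_dotProduct]
  -- `1 - ⟨z, w⟩ = ⟨z, z - w⟩` has modulus at most `d = ‖z - w‖`, and `d ≤ η² + d² / (4 η²)`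
  have h1 : ∀ i, ‖1 - star (z i) ⬝ᵥ w i‖ ≤
      η ^ 2 + ‖WithLp.toLp 2 (z i - w i)‖ ^ 2 / (4 * η ^ 2) := by
    intro i
    have h : 1 - star (z i) ⬝ᵥ w i = star (z i) ⬝ᵥ (z i - w i) := by
      rw [dotProduct_sub, hz]
    have h2 := norm_star_dotProduct_le (z i) (z i - w i)
    rw [← h, norm_toLp_of_star_dotProduct_self (hz i), one_mul] at h2
    refine h2.trans ?_
    obtain ⟨d, hd⟩ : ∃ d, d = ‖WithLp.toLp 2 (z i - w i)‖ := ⟨_, rfl⟩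
    rw [← hd, ← sub_nonneg]
    have : η ^ 2 + d ^ 2 / (4 * η ^ 2) - d = (2 * η ^ 2 - d) ^ 2 / (4 * η ^ 2) := by
      field_simp
      ring
    rw [this]
    positivity
  have h2 : ∀ i, ‖star (z i) ⬝ᵥ w i‖ ≤ 1 := fun i =>
    (norm_star_dotProduct_le _ _).trans_eq (by
      rw [norm_toLp_of_star_dotProduct_self (hz i), norm_toLp_of_star_dotProduct_self (hw i),
        one_mul])
  have h3 : 1 - (∏ c : Fin (s * t), star (z c.divNat) ⬝ᵥ w c.divNat).re ≤
      t * (s * η ^ 2 + (∑ i, ‖WithLp.toLp 2 (z i - w i)‖ ^ 2) / (4 * η ^ 2)) := by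
    calc 1 - (∏ c : Fin (s * t), star (z c.divNat) ⬝ᵥ w c.divNat).re
        = (1 - ∏ c : Fin (s * t), star (z c.divNat) ⬝ᵥ w c.divNat).re := by simp
      _ ≤ ‖1 - ∏ c : Fin (s * t), star (z c.divNat) ⬝ᵥ w c.divNat‖ := Complex.re_le_norm _
      _ ≤ ∑ c : Fin (s * t), ‖1 - star (z c.divNat) ⬝ᵥ w c.divNat‖ :=
          norm_one_sub_prod_le _ _ fun c _ => h2 _
      _ = t * ∑ i, ‖1 - star (z i) ⬝ᵥ w i‖ := sum_divNat fun i => ‖1 - star (z i) ⬝ᵥ w i‖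
      _ ≤ t * ∑ i, (η ^ 2 + ‖WithLp.toLp 2 (z i - w i)‖ ^ 2 / (4 * η ^ 2)) :=
          mul_le_mul_of_nonneg_left (Finset.sum_le_sum fun i _ => h1 i) (Nat.cast_nonneg t)
      _ = _ := by
          rw [Finset.sum_add_distrib, Finset.sum_div]
          simp
  obtain ⟨S, hS⟩ : ∃ S, S = ∑ i, ‖WithLp.toLp 2 (z i - w i)‖ ^ 2 := ⟨_, rfl⟩
  rw [← hS] at h3 ⊢
  calc _ ≤ η + t * (s * η ^ 2 + S / (4 * η ^ 2)) / (2 * η) := by gcongr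
    _ = η * (1 + s * t / 2) + t / (8 * η ^ 3) * S := by
        field_simp
        ring
    _ ≤ _ := by
        have : (0 : ℝ) ≤ s * t := by positivity
        gcongr
        linarith

/-! ### Symmetric orthonormalization -/

lemma ofReal_sum_norm_sq_apply {E F ι : Type*} [NormedAddCommGroup E] [InnerProductSpace ℂ E]
    [FiniteDimensional ℂ E] [NormedAddCommGroup F] [InnerProductSpace ℂ F]
    [FiniteDimensional ℂ F] [Fintype ι] (A : E →ₗ[ℂ] F) (b : OrthonormalBasis ι ℂ E) :
    ((∑ i, ‖A (b i)‖ ^ 2 : ℝ) : ℂ) = LinearMap.trace ℂ E (A.adjoint ∘ₗ A) := by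
  rw [LinearMap.trace_eq_sum_inner _ b, Complex.ofReal_sum]
  refine Finset.sum_congr rfl fun i _ => ?_
  rw [LinearMap.comp_apply, LinearMap.adjoint_inner_right, inner_self_eq_norm_sq_to_K]
  simp

/-- The Hilbert–Schmidt norm does not depend on the orthonormal basis. -/
lemma sum_norm_sq_apply_eq {E F ι ι' : Type*} [NormedAddCommGroup E] [InnerProductSpace ℂ E]
    [FiniteDimensional ℂ E] [NormedAddCommGroup F] [InnerProductSpace ℂ F]
    [FiniteDimensional ℂ F] [Fintype ι] [Fintype ι'] (A : E →ₗ[ℂ] F) (b : OrthonormalBasis ι ℂ E)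
    (b' : OrthonormalBasis ι' ℂ E) : ∑ i, ‖A (b i)‖ ^ 2 = ∑ i, ‖A (b' i)‖ ^ 2 :=
  Complex.ofReal_injective
    ((ofReal_sum_norm_sq_apply A b).trans (ofReal_sum_norm_sq_apply A b').symm)

lemma exists_orthonormalBasis_extension {E ι κ : Type*} [NormedAddCommGroup E]
    [InnerProductSpace ℂ E] [FiniteDimensional ℂ E] [Fintype ι]
    (hE : Module.finrank ℂ E = Fintype.card ι) {c : κ → ι} (hc : Function.Injective c)
    (v : κ → E) (S : Set κ) (hv : Orthonormal ℂ (S.domRestrict v)) :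
    ∃ b : OrthonormalBasis ι ℂ E, ∀ k ∈ S, b (c k) = v k := by
  have hext : ∀ k, Function.extend c v 0 (c k) = v k := fun k => hc.extend_apply _ _ _
  have ho : Orthonormal ℂ ((c '' S).domRestrict (Function.extend c v 0)) := by
    let e : c '' S → S := fun x => ⟨x.2.choose, x.2.choose_spec.1⟩
    have he : ∀ x, c (e x).1 = x.1 := fun x => x.2.choose_spec.2
    have hinj : Function.Injective e := fun x y hxy =>
      Subtype.ext (by rw [← he x, ← he y, hxy])
    convert hv.comp e hinj using 1
    funext x
    change Function.extend c v 0 x.1 = v (e x).1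
    rw [← he x, hext]
  obtain ⟨b, hb⟩ := ho.exists_orthonormalBasis_extension_of_card_eq hE
  exact ⟨b, fun k hk => (hb _ ⟨k, hk, rfl⟩).trans (hext k)⟩

/-- The singular value decomposition of `T`, along an orthonormal basis of eigenvectors of
`T† T`, gives the isometric factor `Q` of the polar decomposition. -/
lemma exists_linearIsometry_polar {H E ι κ : Type*} [NormedAddCommGroup H] [InnerProductSpace ℂ H]
    [FiniteDimensional ℂ H] [NormedAddCommGroup E] [InnerProductSpace ℂ E]
    [FiniteDimensional ℂ E] [Fintype ι] [Fintype κ] [DecidableEq κ]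
    (hE : Module.finrank ℂ E = Fintype.card ι)
    {c : κ → ι} (hc : Function.Injective c) (T : H →ₗ[ℂ] E) (w : OrthonormalBasis κ ℂ H)
    (l : κ → ℝ) (hw : ∀ k, T.adjoint (T (w k)) = (l k : ℂ) • w k) :
    (∀ k, l k = ‖T (w k)‖ ^ 2) ∧
      ∃ Q : H →ₗᵢ[ℂ] E, ∀ k, T (w k) = (‖T (w k)‖ : ℂ) • Q (w k) := by
  have hTT : ∀ k j, inner ℂ (T (w k)) (T (w j)) = if k = j then (l j : ℂ) else 0 := by
    intro k j
    rw [← LinearMap.adjoint_inner_right, hw, inner_smul_right,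
      orthonormal_iff_ite.mp w.orthonormal]
    simp
  have hl : ∀ k, l k = ‖T (w k)‖ ^ 2 := by
    intro k
    have h := hTT k k
    rw [if_pos rfl, inner_self_eq_norm_sq_to_K] at h
    exact Complex.ofReal_injective (by rw [← h]; simp)
  refine ⟨hl, ?_⟩
  -- the left singular vectors, completed to an orthonormal basis
  obtain ⟨e, he⟩ := exists_orthonormalBasis_extension hE hc
    (fun k => ((‖T (w k)‖⁻¹ : ℝ) : ℂ) • T (w k)) {k | T (w k) ≠ 0} (by
      rw [orthonormal_iff_ite]
      rintro ⟨k, hk⟩ ⟨j, hj⟩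
      change inner ℂ (((‖T (w k)‖⁻¹ : ℝ) : ℂ) • T (w k)) (((‖T (w j)‖⁻¹ : ℝ) : ℂ) • T (w j)) = _
      rw [inner_smul_left, inner_smul_right, hTT]
      by_cases hkj : k = j
      · subst hkj
        have hk' : (‖T (w k)‖ : ℂ) ≠ 0 := by simpa using hk
        rw [if_pos rfl, if_pos rfl, hl, Complex.conj_ofReal]
        push_cast
        field_simp
      · rw [if_neg hkj, if_neg (by simpa using hkj), mul_zero, mul_zero])
  have hQo : Orthonormal ℂ (w.toBasis.constr ℂ (e ∘ c) ∘ w.toBasis) := by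
    have h : w.toBasis.constr ℂ (e ∘ c) ∘ w.toBasis = e ∘ c :=
      funext fun k => w.toBasis.constr_basis ℂ _ k
    rw [h]
    exact e.orthonormal.comp c hc
  refine ⟨(w.toBasis.constr ℂ (e ∘ c)).isometryOfOrthonormal (v := w.toBasis)
    (by rw [w.coe_toBasis]; exact w.orthonormal) hQo, fun k => ?_⟩
  have hQ : w.toBasis.constr ℂ (e ∘ c) (w k) = e (c k) := by
    rw [← w.coe_toBasis]
    exact w.toBasis.constr_basis ℂ _ k
  rw [LinearMap.coe_isometryOfOrthonormal, hQ]
  by_cases hk : T (w k) = 0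
  · simp [hk]
  · have hk' : (‖T (w k)‖ : ℂ) ≠ 0 := by simpa using hk
    rw [he k hk, smul_smul]
    push_cast
    rw [mul_inv_cancel₀ hk', one_smul]

/-- The isometric factor of the polar decomposition is near `T` when `T† T` is near the identity:
with `σ` the singular values of `T`, the two sides are `∑ (σ - 1)²` and `∑ (σ² - 1)²`. -/
lemma exists_linearIsometry_near {H E ι : Type*} [NormedAddCommGroup H] [InnerProductSpace ℂ H]
    [FiniteDimensional ℂ H] [NormedAddCommGroup E] [InnerProductSpace ℂ E]
    [FiniteDimensional ℂ E] [Fintype ι] (hE : Module.finrank ℂ E = Fintype.card ι) {s : ℕ}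
    {c : Fin s → ι} (hc : Function.Injective c) (T : H →ₗ[ℂ] E)
    (e₀ : OrthonormalBasis (Fin s) ℂ H) :
    ∃ Q : H →ₗᵢ[ℂ] E, ∑ i, ‖T (e₀ i) - Q (e₀ i)‖ ^ 2 ≤
      ∑ i, ‖T.adjoint (T (e₀ i)) - e₀ i‖ ^ 2 := by
  have hG : (T.adjoint ∘ₗ T).IsSymmetric := fun x y => by
    simp [LinearMap.adjoint_inner_left, LinearMap.adjoint_inner_right]
  have hH : Module.finrank ℂ H = s := by
    rw [Module.finrank_eq_card_basis e₀.toBasis, Fintype.card_fin]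
  obtain ⟨w, l, hw⟩ : ∃ (w : OrthonormalBasis (Fin s) ℂ H) (l : Fin s → ℝ),
      ∀ k, T.adjoint (T (w k)) = (l k : ℂ) • w k :=
    ⟨hG.eigenvectorBasis hH, hG.eigenvalues hH, hG.apply_eigenvectorBasis hH⟩
  obtain ⟨hl, Q, hQ⟩ := exists_linearIsometry_polar hE hc T w l hw
  refine ⟨Q, ?_⟩
  have h1 := sum_norm_sq_apply_eq (T - Q.toLinearMap) e₀ w
  have h2 := sum_norm_sq_apply_eq (T.adjoint ∘ₗ T - LinearMap.id) e₀ w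
  simp only [LinearMap.sub_apply, LinearIsometry.coe_toLinearMap, LinearMap.comp_apply,
    LinearMap.id_apply] at h1 h2
  rw [h1, h2]
  refine Finset.sum_le_sum fun k _ => ?_
  have h3 : T (w k) - Q (w k) = ((‖T (w k)‖ - 1 : ℝ) : ℂ) • Q (w k) := by
    conv_lhs => rw [hQ k]
    push_cast
    rw [sub_smul, one_smul]
  have h4 : T.adjoint (T (w k)) - w k = ((‖T (w k)‖ ^ 2 - 1 : ℝ) : ℂ) • w k := by
    rw [hw, hl]
    push_cast
    rw [sub_smul, one_smul]
  rw [h3, h4, norm_smul, norm_smul, Q.norm_map, w.orthonormal.1, mul_one, mul_one,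
    Complex.norm_real, Complex.norm_real, Real.norm_eq_abs, Real.norm_eq_abs, sq_abs, sq_abs]
  have h0 := norm_nonneg (T (w k))
  have hfac : (‖T (w k)‖ ^ 2 - 1) ^ 2 = (‖T (w k)‖ - 1) ^ 2 * (‖T (w k)‖ + 1) ^ 2 := by ring
  rw [hfac]
  exact le_mul_of_one_le_right (sq_nonneg _) (by nlinarith)

/-- Vectors whose Gram matrix is close to the identity are close to an orthonormal family, which
is part of an orthonormal basis. -/
lemma exists_orthonormalBasis_near {E ι : Type*} [NormedAddCommGroup E] [InnerProductSpace ℂ E]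
    [FiniteDimensional ℂ E] [Fintype ι] (hE : Module.finrank ℂ E = Fintype.card ι) {s : ℕ}
    {c : Fin s → ι} (hc : Function.Injective c) (z : Fin s → E) :
    ∃ b : OrthonormalBasis ι ℂ E, ∑ i, ‖z i - b (c i)‖ ^ 2 ≤
      ∑ i, ∑ j, ‖inner ℂ (z i) (z j) - if i = j then 1 else 0‖ ^ 2 := by
  obtain ⟨e₀⟩ : Nonempty (OrthonormalBasis (Fin s) ℂ (EuclideanSpace ℂ (Fin s))) :=
    ⟨EuclideanSpace.basisFun (Fin s) ℂ⟩
  obtain ⟨T, hT⟩ : ∃ T : EuclideanSpace ℂ (Fin s) →ₗ[ℂ] E, ∀ i, T (e₀ i) = z i :=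
    ⟨e₀.toBasis.constr ℂ z, fun i => by
      rw [← e₀.coe_toBasis]
      exact e₀.toBasis.constr_basis ℂ z i⟩
  obtain ⟨Q, hQ⟩ := exists_linearIsometry_near hE hc T e₀
  obtain ⟨b, hb⟩ := exists_orthonormalBasis_extension hE hc (fun i => Q (e₀ i)) Set.univ
    ((e₀.orthonormal.comp_linearIsometry Q).comp _ Subtype.val_injective)
  refine ⟨b, ?_⟩
  calc ∑ i, ‖z i - b (c i)‖ ^ 2 = ∑ i, ‖T (e₀ i) - Q (e₀ i)‖ ^ 2 :=
        Finset.sum_congr rfl fun i _ => by rw [hb i trivial, hT]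
    _ ≤ ∑ j, ‖T.adjoint (T (e₀ j)) - e₀ j‖ ^ 2 := hQ
    _ = ∑ j, ∑ i, ‖inner ℂ (e₀ i) (T.adjoint (T (e₀ j)) - e₀ j)‖ ^ 2 :=
        Finset.sum_congr rfl fun j _ => (e₀.sum_sq_norm_inner_right _).symm
    _ = _ := by
        rw [Finset.sum_comm]
        refine Finset.sum_congr rfl fun i _ => Finset.sum_congr rfl fun j _ => ?_
        rw [inner_sub_right, orthonormal_iff_ite.mp e₀.orthonormal,
          LinearMap.adjoint_inner_right, hT, hT]

/-! ### Haar unitaries and Haar states -/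

instance instSecondCountableUnitary (N : ℕ) :
    SecondCountableTopology (Matrix.unitaryGroup (Reg N) ℂ) :=
  inferInstanceAs
    (SecondCountableTopology {A : Reg N → Reg N → ℂ // A ∈ Matrix.unitaryGroup (Reg N) ℂ})

instance instIsHaarMeasureHaarUnitary (N : ℕ) : (haarUnitary N).IsHaarMeasure := by
  unfold haarUnitary
  infer_instance

/-- A translate of the Haar probability measure is again one. -/
instance instIsMulRightInvariantHaarUnitary (N : ℕ) : (haarUnitary N).IsMulRightInvariant :=
  ⟨fun g => by
    have : IsProbabilityMeasure (Measure.map (· * g) (haarUnitary N)) :=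
      Measure.isProbabilityMeasure_map (measurable_mul_const g).aemeasurable
    exact Measure.isHaarMeasure_eq_of_isProbabilityMeasure _ _⟩

/-- The column `U|x⟩` of a unitary. -/
def col {N : ℕ} (U : Matrix.unitaryGroup (Reg N) ℂ) (x : Reg N) : Reg N → ℂ := fun y => U.1 y x

lemma continuous_col {N : ℕ} (x : Reg N) :
    Continuous fun U : Matrix.unitaryGroup (Reg N) ℂ => col U x :=
  continuous_pi fun y => (continuous_apply x).comp ((continuous_apply y).comp continuous_subtype_val)

lemma haarState_eq_map (N : ℕ) : haarState N = (haarUnitary N).map fun U => col U (zeros N) := rfl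

lemma star_col_dotProduct_col {N : ℕ} (U : Matrix.unitaryGroup (Reg N) ℂ) (x y : Reg N) :
    star (col U x) ⬝ᵥ col U y = if x = y then 1 else 0 := by
  have h := congrFun (congrFun (Matrix.mem_unitaryGroup_iff'.mp U.2) x) y
  rw [Matrix.mul_apply, Matrix.one_apply] at h
  exact h

lemma col_mul {N : ℕ} (U V : Matrix.unitaryGroup (Reg N) ℂ) (x : Reg N) :
    col (U * V) x = U.1.mulVec (col V x) := by
  funext y
  exact Matrix.mul_apply

lemma star_mulVec_dotProduct_mulVec {N : ℕ} (U : Matrix.unitaryGroup (Reg N) ℂ)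
    (v w : Reg N → ℂ) : star (U.1.mulVec v) ⬝ᵥ U.1.mulVec w = star v ⬝ᵥ w := by
  have h : U.1.conjTranspose * U.1 = 1 := Matrix.mem_unitaryGroup_iff'.mp U.2
  rw [Matrix.star_mulVec, Matrix.dotProduct_mulVec, Matrix.vecMul_vecMul, h, Matrix.vecMul_one]

lemma norm_toLp_mulVec {N : ℕ} (U : Matrix.unitaryGroup (Reg N) ℂ) (v : Reg N → ℂ) :
    ‖WithLp.toLp 2 (U.1.mulVec v)‖ = ‖WithLp.toLp 2 v‖ := by
  rw [@norm_eq_sqrt_re_inner ℂ, @norm_eq_sqrt_re_inner ℂ, EuclideanSpace.inner_eq_star_dotProduct,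
    EuclideanSpace.inner_eq_star_dotProduct, dotProduct_comm, star_mulVec_dotProduct_mulVec,
    dotProduct_comm]

/-- The unitary whose columns are the vectors of an orthonormal basis. -/
lemma exists_unitary_col_eq {N : ℕ} (b : OrthonormalBasis (Reg N) ℂ (EuclideanSpace ℂ (Reg N))) :
    ∃ W : Matrix.unitaryGroup (Reg N) ℂ, ∀ x, WithLp.toLp 2 (col W x) = b x := by
  refine ⟨⟨Matrix.of fun y x => b x y, Matrix.mem_unitaryGroup_iff'.mpr ?_⟩, fun x => rfl⟩
  ext x y
  have h := orthonormal_iff_ite.mp b.orthonormal x y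
  rw [EuclideanSpace.inner_eq_star_dotProduct, dotProduct_comm] at h
  rw [Matrix.mul_apply, Matrix.one_apply]
  exact h

lemma exists_unitary_col_near {s N : ℕ} {c : Fin s → Reg N} (hc : Function.Injective c)
    (z : Fin s → Reg N → ℂ) :
    ∃ W : Matrix.unitaryGroup (Reg N) ℂ, ∑ i, ‖WithLp.toLp 2 (z i - col W (c i))‖ ^ 2 ≤
      ∑ i, ∑ j, ‖star (z i) ⬝ᵥ z j - if i = j then 1 else 0‖ ^ 2 := by
  obtain ⟨b, hb⟩ := exists_orthonormalBasis_near (E := EuclideanSpace ℂ (Reg N)) (by simp) hc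
    fun i => WithLp.toLp 2 (z i)
  obtain ⟨W, hW⟩ := exists_unitary_col_eq b
  refine ⟨W, ?_⟩
  simp only [EuclideanSpace.inner_eq_star_dotProduct, ← hW] at hb
  simp only [dotProduct_comm (star (z _)), WithLp.toLp_sub]
  exact hb

lemma exists_unitary_col_mul_eq {N : ℕ} (x y : Reg N) :
    ∃ P : Matrix.unitaryGroup (Reg N) ℂ, ∀ U, col (U * P) x = col U y := by
  obtain ⟨P, hP⟩ := exists_unitary_col_eq
    ((EuclideanSpace.basisFun (Reg N) ℂ).reindex (Equiv.swap y x))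
  refine ⟨P, fun U => ?_⟩
  have h : col P x = Pi.single y 1 := by
    have h := congrArg WithLp.ofLp (hP x)
    rw [OrthonormalBasis.reindex_apply, Equiv.symm_swap, Equiv.swap_apply_right] at h
    simpa using h
  rw [col_mul, h]
  funext k
  simp [col]

lemma integrable_of_continuous {X : Type*} [TopologicalSpace X] [CompactSpace X]
    [MeasurableSpace X] [OpensMeasurableSpace X] {μ : Measure X} [IsFiniteMeasure μ] {f : X → ℝ}
    (hf : Continuous f) : Integrable f μ := by
  obtain ⟨C, hC⟩ := isCompact_univ.exists_bound_of_continuousOn hf.continuousOn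
  exact Integrable.of_bound hf.aestronglyMeasurable C (ae_of_all _ fun x => hC x (Set.mem_univ x))

/-- The law of independent Haar unitaries. -/
abbrev haarUnitaries (s N : ℕ) : Measure (Fin s → Matrix.unitaryGroup (Reg N) ℂ) :=
  Measure.pi fun _ => haarUnitary N

lemma continuous_normSq_overlap {s N : ℕ} (i j : Fin s) (x y : Reg N) :
    Continuous fun U : Fin s → Matrix.unitaryGroup (Reg N) ℂ =>
      ‖star (col (U i) x) ⬝ᵥ col (U j) y‖ ^ 2 := by
  have h1 : Continuous fun U : Fin s → Matrix.unitaryGroup (Reg N) ℂ => col (U i) x :=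
    (continuous_col x).comp (continuous_apply i)
  have h2 : Continuous fun U : Fin s → Matrix.unitaryGroup (Reg N) ℂ => col (U j) y :=
    (continuous_col y).comp (continuous_apply j)
  exact ((Continuous.dotProduct (continuous_star.comp h1) h2).norm).pow 2

/-- By right invariance all columns of `U i` have the same expected squared overlap with a column
of `U j`; by Parseval these `2 ^ N` squared overlaps add up to one. -/
lemma integral_normSq_overlap {s N : ℕ} {i j : Fin s} (hij : i ≠ j) (x y : Reg N) :
    ∫ U, ‖star (col (U i) x) ⬝ᵥ col (U j) y‖ ^ 2 ∂haarUnitaries s N = (2 ^ N)⁻¹ := by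
  classical
  have hx : ∀ x', ∫ U, ‖star (col (U i) x') ⬝ᵥ col (U j) y‖ ^ 2 ∂haarUnitaries s N =
      ∫ U, ‖star (col (U i) x) ⬝ᵥ col (U j) y‖ ^ 2 ∂haarUnitaries s N := by
    intro x'
    obtain ⟨P, hP⟩ := exists_unitary_col_mul_eq x x'
    rw [← integral_mul_right_eq_self (μ := haarUnitaries s N)
      (fun U : Fin s → Matrix.unitaryGroup (Reg N) ℂ => ‖star (col (U i) x) ⬝ᵥ col (U j) y‖ ^ 2)
      (Pi.mulSingle i P)]
    simp only [Pi.mul_apply, Pi.mulSingle_eq_same, Pi.mulSingle_eq_of_ne hij.symm, mul_one, hP]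
  have hsum : ∀ U : Fin s → Matrix.unitaryGroup (Reg N) ℂ,
      ∑ x', ‖star (col (U i) x') ⬝ᵥ col (U j) y‖ ^ 2 = 1 := by
    intro U
    have h1 : ∀ x', star (col (U i) x') ⬝ᵥ col (U j) y = col ((U i)⁻¹ * U j) y x' := fun x' => by
      rw [col_mul]
      rfl
    simp only [h1]
    rw [← EuclideanSpace.norm_sq_eq (WithLp.toLp 2 (col ((U i)⁻¹ * U j) y)),
      norm_toLp_of_star_dotProduct_self (by rw [star_col_dotProduct_col, if_pos rfl]), one_pow]
  have htot : ∑ x', ∫ U, ‖star (col (U i) x') ⬝ᵥ col (U j) y‖ ^ 2 ∂haarUnitaries s N = 1 := by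
    rw [← integral_finsetSum _ fun x' _ =>
      integrable_of_continuous (continuous_normSq_overlap i j x' y)]
    simp [hsum]
  rw [Finset.sum_congr rfl fun x' _ => hx x', Finset.sum_const, nsmul_eq_mul] at htot
  refine eq_inv_of_mul_eq_one_right (Eq.trans ?_ htot)
  simp

/-! ### Columns of a Haar unitary against independent Haar states -/

lemma continuous_acceptCopies {𝒢 : GateSet} {a s t N : ℕ} (D : Circuit 𝒢 (a + s * t * N) 1)
    (τ : Op a) : Continuous (acceptCopies D τ) := by
  refine D.continuous_accept.comp (continuous_pi fun x => continuous_pi fun y => ?_)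
  refine continuous_const.mul (continuous_finsetProd _ fun c _ => ?_)
  have h : ∀ u : Reg N, Continuous fun z : Fin s → Reg N → ℂ => z c.divNat u := fun u =>
    (continuous_apply u).comp (continuous_apply c.divNat)
  exact (h _).mul (continuous_star.comp (h _))

/-- Averaged over a joint rotation, any unit vectors look like the same number of columns of a
Haar unitary, up to an error that is controlled by their Gram matrix. -/
lemma abs_integral_rotated_sub_integral_columns_le {𝒢 : GateSet} {a s t N : ℕ}
    (D : Circuit 𝒢 (a + s * t * N) 1) {τ : Op a} (hτ : IsDensity τ) {c : Fin s → Reg N}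
    (hc : Function.Injective c) {η : ℝ} (hη : 0 < η)
    (U : Fin s → Matrix.unitaryGroup (Reg N) ℂ) (x : Reg N) :
    |∫ V, acceptCopies D τ (fun i => col (V * U i) x) ∂haarUnitary N -
        ∫ V, acceptCopies D τ (fun i => col V (c i)) ∂haarUnitary N| ≤
      η * (1 + s * t) + t / (8 * η ^ 3) *
        ∑ i, ∑ j, ‖star (col (U i) x) ⬝ᵥ col (U j) x - if i = j then 1 else 0‖ ^ 2 := by
  obtain ⟨W, hW⟩ := exists_unitary_col_near hc fun i => col (U i) x
  have h1 : Continuous fun V => acceptCopies D τ (fun i => col (V * U i) x) :=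
    (continuous_acceptCopies D τ).comp
      (continuous_pi fun i => (continuous_col x).comp (continuous_mul_const (U i)))
  have h2 : Continuous fun V => acceptCopies D τ (fun i => col (V * W) (c i)) :=
    (continuous_acceptCopies D τ).comp
      (continuous_pi fun i => (continuous_col (c i)).comp (continuous_mul_const W))
  -- right invariance replaces the columns of `V` by those of `V * W`, which are close to `V * U i`
  rw [← integral_mul_right_eq_self (fun V => acceptCopies D τ (fun i => col V (c i))) W,
    ← integral_sub (integrable_of_continuous h1) (integrable_of_continuous h2),
    ← Real.norm_eq_abs]
  refine (norm_integral_le_of_norm_le_const (ae_of_all _ fun V => ?_)).trans_eq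
    (by rw [probReal_univ, mul_one])
  have h3 : ∀ i, ‖WithLp.toLp 2 (col (V * U i) x - col (V * W) (c i))‖ =
      ‖WithLp.toLp 2 (col (U i) x - col W (c i))‖ := fun i => by
    rw [col_mul, col_mul, ← Matrix.mulVec_sub, norm_toLp_mulVec]
  have h4 := abs_acceptCopies_sub_le D hτ (z := fun i => col (V * U i) x)
    (w := fun i => col (V * W) (c i)) (fun i => by rw [star_col_dotProduct_col, if_pos rfl])
    (fun i => by rw [star_col_dotProduct_col, if_pos rfl]) hη
  simp only [h3] at h4
  rw [Real.norm_eq_abs]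
  exact h4.trans (add_le_add le_rfl (mul_le_mul_of_nonneg_left hW (by positivity)))

lemma integral_haarStates_eq {s N : ℕ} {f : (Fin s → Reg N → ℂ) → ℝ} (hf : Continuous f) :
    ∫ ϑ, f ϑ ∂Measure.pi (fun _ => haarState N) =
      ∫ U, f (fun i => col (U i) (zeros N)) ∂haarUnitaries s N := by
  have hmeas : Measurable fun U : Matrix.unitaryGroup (Reg N) ℂ => col U (zeros N) :=
    (continuous_col (zeros N)).measurable
  have hpi := Measure.pi_map_pi (μ := fun _ : Fin s => haarUnitary N)
    (f := fun _ U => col U (zeros N))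
    (hμ := fun _ => inferInstanceAs (SigmaFinite (haarState N))) fun _ => hmeas.aemeasurable
  simp only [haarState_eq_map]
  rw [← hpi, integral_map]
  · exact (measurable_pi_lambda _ fun i => hmeas.comp (measurable_pi_apply i)).aemeasurable
  · exact hf.aestronglyMeasurable

/-- Independent Haar states are jointly invariant under rotations, so they may be averaged over a
rotation by one more Haar unitary. -/
lemma integral_haarStates_eq_integral_rotated {s N : ℕ} {f : (Fin s → Reg N → ℂ) → ℝ}
    (hf : Continuous f) :
    ∫ ϑ, f ϑ ∂Measure.pi (fun _ => haarState N) =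
      ∫ U, ∫ V, f (fun i => col (V * U i) (zeros N)) ∂haarUnitary N ∂haarUnitaries s N := by
  have hcont : Continuous fun p : (Fin s → Matrix.unitaryGroup (Reg N) ℂ) ×
      Matrix.unitaryGroup (Reg N) ℂ => f (fun i => col (p.2 * p.1 i) (zeros N)) :=
    hf.comp (continuous_pi fun i => (continuous_col (zeros N)).comp
      (continuous_snd.mul ((continuous_apply i).comp continuous_fst)))
  rw [integral_haarStates_eq hf, integral_integral_swap (integrable_of_continuous hcont)]
  have hV : ∀ V : Matrix.unitaryGroup (Reg N) ℂ,
      ∫ U, f (fun i => col (V * U i) (zeros N)) ∂haarUnitaries s N =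
        ∫ U, f (fun i => col (U i) (zeros N)) ∂haarUnitaries s N := fun V =>
    integral_mul_left_eq_self (μ := haarUnitaries s N)
      (fun U : Fin s → Matrix.unitaryGroup (Reg N) ℂ => f fun i => col (U i) (zeros N)) fun _ => V
  simp only [hV, integral_const, probReal_univ, one_smul]

lemma continuous_gram_entry {s N : ℕ} (i j : Fin s) (x : Reg N) (r : ℂ) :
    Continuous fun U : Fin s → Matrix.unitaryGroup (Reg N) ℂ =>
      ‖star (col (U i) x) ⬝ᵥ col (U j) x - r‖ ^ 2 := by
  have h : ∀ i, Continuous fun U : Fin s → Matrix.unitaryGroup (Reg N) ℂ => col (U i) x :=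
    fun i => (continuous_col x).comp (continuous_apply i)
  exact (((Continuous.dotProduct (continuous_star.comp (h i)) (h j)).sub
    continuous_const).norm).pow 2

/-- Columns of one Haar unitary are statistically close to independent Haar states. -/
lemma abs_integral_columns_sub_integral_haarStates_le {𝒢 : GateSet} {a s t N : ℕ}
    (D : Circuit 𝒢 (a + s * t * N) 1) {τ : Op a} (hτ : IsDensity τ) {c : Fin s → Reg N}
    (hc : Function.Injective c) {η : ℝ} (hη : 0 < η) :
    |∫ V, acceptCopies D τ (fun i => col V (c i)) ∂haarUnitary N -
        ∫ ϑ, acceptCopies D τ ϑ ∂Measure.pi (fun _ => haarState N)| ≤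
      η * (1 + s * t) + t / (8 * η ^ 3) * (s ^ 2 * (2 ^ N)⁻¹) := by
  have hg : ∀ i j : Fin s, Integrable (fun U : Fin s → Matrix.unitaryGroup (Reg N) ℂ =>
      ‖star (col (U i) (zeros N)) ⬝ᵥ col (U j) (zeros N) - if i = j then 1 else 0‖ ^ 2)
      (haarUnitaries s N) := fun i j =>
    integrable_of_continuous (continuous_gram_entry i j (zeros N) _)
  have hgram : ∫ U, ∑ i, ∑ j, ‖star (col (U i) (zeros N)) ⬝ᵥ col (U j) (zeros N) -
      if i = j then 1 else 0‖ ^ 2 ∂haarUnitaries s N ≤ s ^ 2 * (2 ^ N)⁻¹ := by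
    rw [integral_finsetSum _ fun i _ => integrable_finsetSum _ fun j _ => hg i j]
    simp only [fun i => integral_finsetSum Finset.univ fun j _ => hg i j]
    calc _ ≤ ∑ _i : Fin s, ∑ _j : Fin s, ((2 : ℝ) ^ N)⁻¹ := by
          refine Finset.sum_le_sum fun i _ => Finset.sum_le_sum fun j _ => ?_
          by_cases hij : i = j
          · subst hij
            simp [star_col_dotProduct_col]
          · simp only [if_neg hij, sub_zero]
            exact (integral_normSq_overlap hij _ _).le
      _ = _ := by
          simp
          ring
  rw [abs_sub_comm, integral_haarStates_eq_integral_rotated (continuous_acceptCopies D τ)]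
  have hcont : Continuous fun p : (Fin s → Matrix.unitaryGroup (Reg N) ℂ) ×
      Matrix.unitaryGroup (Reg N) ℂ =>
        acceptCopies D τ (fun i => col (p.2 * p.1 i) (zeros N)) :=
    (continuous_acceptCopies D τ).comp (continuous_pi fun i => (continuous_col (zeros N)).comp
      (continuous_snd.mul ((continuous_apply i).comp continuous_fst)))
  have hint : Integrable (fun U : Fin s → Matrix.unitaryGroup (Reg N) ℂ =>
      ∫ V, acceptCopies D τ (fun i => col (V * U i) (zeros N)) ∂haarUnitary N)
      (haarUnitaries s N) :=
    (integrable_of_continuous (μ := (haarUnitaries s N).prod (haarUnitary N))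
      hcont).integral_prod_left
  have hconst : ∫ V, acceptCopies D τ (fun i => col V (c i)) ∂haarUnitary N =
      ∫ _U, ∫ V, acceptCopies D τ (fun i => col V (c i)) ∂haarUnitary N ∂haarUnitaries s N := by
    simp
  rw [hconst, ← integral_sub hint (integrable_const _), ← Real.norm_eq_abs]
  have hsum := integrable_finsetSum Finset.univ fun i _ =>
    integrable_finsetSum Finset.univ fun j _ => hg i j
  refine (norm_integral_le_of_norm_le
    ((integrable_const (η * (1 + s * t))).add (hsum.const_mul (t / (8 * η ^ 3))))
    (ae_of_all _ fun U => abs_integral_rotated_sub_integral_columns_le D hτ hc hη U _)).trans ?_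
  simp only [Pi.add_apply]
  rw [integral_add (integrable_const _) (hsum.const_mul _), integral_const,
    probReal_univ, one_smul, integral_const_mul]
  exact add_le_add le_rfl (mul_le_mul_of_nonneg_left hgram (by positivity))

/-! ### Negligible functions -/

lemma PolyBounded.add {f g : ℕ → ℕ} (hf : PolyBounded f) (hg : PolyBounded g) :
    PolyBounded fun κ => f κ + g κ := by
  obtain ⟨p, hp⟩ := hf
  obtain ⟨r, hr⟩ := hg
  exact ⟨p + r, fun κ => by rw [Polynomial.eval_add]; exact add_le_add (hp κ) (hr κ)⟩

lemma PolyBounded.mul {f g : ℕ → ℕ} (hf : PolyBounded f) (hg : PolyBounded g) :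
    PolyBounded fun κ => f κ * g κ := by
  obtain ⟨p, hp⟩ := hf
  obtain ⟨r, hr⟩ := hg
  exact ⟨p * r, fun κ => by rw [Polynomial.eval_mul]; exact Nat.mul_le_mul (hp κ) (hr κ)⟩

lemma PolyBounded.const (b : ℕ) : PolyBounded fun _ => b := ⟨Polynomial.C b, fun _ => by simp⟩

lemma Negligible.of_eventually_abs_le {ε δ : ℕ → ℝ} (hε : Negligible ε)
    (h : ∀ᶠ κ in atTop, |δ κ| ≤ ε κ) : Negligible δ :=
  hε.trans_eventually_abs_le (h.mono fun _ hκ => hκ.trans (le_abs_self _))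

lemma Negligible.polyBounded_mul {f : ℕ → ℕ} {ε : ℕ → ℝ} (hf : PolyBounded f)
    (hε : Negligible ε) : Negligible fun κ => (f κ : ℝ) * ε κ := by
  obtain ⟨p, hp⟩ := hf
  refine (hε.polynomial_mul (p.map (Nat.castRingHom ℝ))).trans_abs_le fun κ => ?_
  have h : (f κ : ℝ) ≤ Polynomial.eval (κ : ℝ) (p.map (Nat.castRingHom ℝ)) := by
    rw [Polynomial.eval_natCast_map]
    exact Nat.cast_le.mpr (hp κ)
  rw [abs_mul, abs_mul, abs_of_nonneg (Nat.cast_nonneg (f κ))]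
  exact mul_le_mul_of_nonneg_right (h.trans (le_abs_self _)) (abs_nonneg _)

lemma Negligible.sqrt {ε : ℕ → ℝ} (hε : Negligible ε) : Negligible fun κ => √(ε κ) := by
  intro c
  have h := (Real.continuous_sqrt.tendsto 0).comp (hε (2 * c))
  rw [Real.sqrt_zero] at h
  refine h.congr fun κ => ?_
  rw [Function.comp_apply, Real.sqrt_mul (by positivity), mul_comm 2 c, pow_mul,
    Real.sqrt_sq (by positivity)]

/-! ### From pseudorandom isometries to pseudorandom states -/

/-- The circuit in which the last input wires become ancilla wires. -/
def Circuit.zeroInput {𝒢 : GateSet} {a b out : ℕ} (C : Circuit 𝒢 (a + b) out) :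
    Circuit 𝒢 a out where
  wires := C.wires
  le := (Nat.le_add_right a b).trans C.le
  gates := C.gates
  output := C.output

lemma Circuit.run_zeroInput {𝒢 : GateSet} {a b out : ℕ} (C : Circuit 𝒢 (a + b) out) (ρ : Op a) :
    C.zeroInput.run ρ = C.run (tensor ρ (basisOp (zeros b))) := by
  have hz : ∀ x : Reg C.wires, (∀ i : Fin C.wires, a ≤ i.val → x i = false) ↔
      (∀ i : Fin C.wires, a + b ≤ i.val → x i = false) ∧
        sndPart (fun j : Fin (a + b) => x (Fin.castLE C.le j)) = zeros b := by
    intro x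
    constructor
    · exact fun h => ⟨fun i hi => h i (by omega), funext fun j => h _ (by simp)⟩
    · rintro ⟨h1, h2⟩ i hi
      by_cases hi' : a + b ≤ i.val
      · exact h1 i hi'
      · have h := congrFun h2 ⟨i.val - a, by omega⟩
        simp only [sndPart, zeros] at h
        rw [← h]
        congr 1
        ext
        simp
        omega
  have hinit : (C.zeroInput.initial ρ : Op C.wires) =
      C.initial (tensor ρ (basisOp (zeros b))) := by
    ext x y
    by_cases h : ∀ i : Fin C.wires, a ≤ i.val → x i = false ∧ y i = false
    · have hx := (hz x).mp fun i hi => (h i hi).1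
      have hy := (hz y).mp fun i hi => (h i hi).2
      refine (if_pos h).trans (Eq.symm ((if_pos fun i hi => ⟨hx.1 i hi, hy.1 i hi⟩).trans ?_))
      rw [tensor, basisOp_apply, if_pos hx.2, if_pos hy.2, mul_one, mul_one]
      rfl
    · refine (if_neg h).trans (Eq.symm ?_)
      simp only [Circuit.initial, tensor, basisOp_apply]
      split_ifs with h1 h2 h3
      · exact absurd (fun i hi => ⟨(hz x).mpr ⟨fun i hi => (h1 i hi).1, h2⟩ i hi,
          (hz y).mpr ⟨fun i hi => (h1 i hi).2, h3⟩ i hi⟩) h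
      all_goals simp
  exact congrArg (fun σ : Op C.wires => C.traceOut (C.unitary * σ * C.unitary.conjTranspose)) hinit

lemma append_zeros (a b : ℕ) : Fin.append (zeros a) (zeros b) = zeros (a + b) := by
  funext i
  refine Fin.addCases (fun i => ?_) (fun i => ?_) i <;> simp [zeros]

/-- The security of a pseudorandom isometry, for advice `τ` and classical queries `x`, as the
negligibility of a distinguishing advantage. -/
lemma IsQCompPRI.negligible_advantage {𝒢 : GateSet} {n m : ℕ → ℕ}
    {F : (κ : ℕ) → Circuit 𝒢 (κ + n κ) (n κ + m κ)} (hF : IsQCompPRI n m F) {q ℓ : ℕ → ℕ}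
    (hq : PolyBounded q) (hℓ : PolyBounded ℓ)
    (D : (κ : ℕ) → Circuit 𝒢 (ℓ κ + q κ * (n κ + m κ)) 1) (hD : IsPolySize D)
    {τ : (κ : ℕ) → Op (ℓ κ)} (hτ : ∀ κ, IsDensity (τ κ)) (x : (κ : ℕ) → Fin (q κ) → Reg (n κ)) :
    Negligible fun κ =>
      |keyAvg (fun k : Reg κ => (D κ).accept
          (tensor (τ κ) (tensorAll fun i => keyed (F κ) k (basisOp (x κ i))))) -
        ∫ U, (D κ).accept (tensor (τ κ) (tensorAll fun i =>
          pureOp (col U (Fin.append (x κ i) (zeros (m κ)))))) ∂haarUnitary (n κ + m κ)| := by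
  obtain ⟨ε, hε, h⟩ := hF.secure q ℓ hq hℓ D hD
  refine hε.of_eventually_abs_le (h.mono fun κ hκ => ?_)
  rw [abs_abs]
  have h' := hκ _ ⟨τ κ, hτ κ, x κ, rfl⟩
  simp only [parallel_tensor_basisOp, conj_isometryOf_basisOp] at h'
  exact h'

lemma isPRSG_zeroInput {𝒢 : GateSet} {n m : ℕ → ℕ}
    {F : (κ : ℕ) → Circuit 𝒢 (κ + n κ) (n κ + m κ)} (hF : IsQCompPRI n m F) :
    IsPRSG (fun κ => n κ + m κ) fun κ => (F κ).zeroInput where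
  qpt := ⟨hF.qpt.1, hF.qpt.2⟩
  pseudorandom t a ht ha adv hadv D hD := by
    refine ⟨_, hF.negligible_advantage ht ha D hD hadv fun κ _ => zeros (n κ), fun κ => ?_⟩
    have hc : Continuous fun ϑ : Reg (n κ + m κ) → ℂ =>
        (D κ).accept (tensor (adv κ) (tensorAll fun _ : Fin (t κ) => pureOp ϑ)) := by
      refine (D κ).continuous_accept.comp (continuous_pi fun x => continuous_pi fun y => ?_)
      refine continuous_const.mul (continuous_finsetProd _ fun c _ => ?_)
      exact (continuous_apply _).mul (continuous_star.comp (continuous_apply _))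
    rw [haarState_eq_map, integral_map (continuous_col _).aemeasurable hc.aestronglyMeasurable]
    simp only [Circuit.run_zeroInput, append_zeros]
    exact le_rfl

/-- Choosing `η ^ 4 = 2 ^ (-N)` balances the two error terms. -/
lemma abs_integral_columns_sub_integral_haarStates_le_sqrt {𝒢 : GateSet} {a s t N : ℕ}
    (D : Circuit 𝒢 (a + s * t * N) 1) {τ : Op a} (hτ : IsDensity τ) {c : Fin s → Reg N}
    (hc : Function.Injective c) :
    |∫ V, acceptCopies D τ (fun i => col V (c i)) ∂haarUnitary N -
        ∫ ϑ, acceptCopies D τ ϑ ∂Measure.pi (fun _ => haarState N)| ≤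
      (1 + s * t + t * (s * s) : ℕ) * √√((2 : ℝ) ^ N)⁻¹ := by
  obtain ⟨η, hη⟩ : ∃ η, η = √√((2 : ℝ) ^ N)⁻¹ := ⟨_, rfl⟩
  have hpos : 0 < η := by
    rw [hη]
    positivity
  have h4 : ((2 : ℝ) ^ N)⁻¹ = η ^ 4 := by
    rw [hη, show 4 = 2 * 2 from rfl, pow_mul, Real.sq_sqrt (by positivity),
      Real.sq_sqrt (by positivity)]
  refine (abs_integral_columns_sub_integral_haarStates_le D hτ hc hpos).trans ?_
  rw [← hη, h4]
  have h : η * (1 + s * t) + t / (8 * η ^ 3) * (s ^ 2 * η ^ 4) =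
      η * (1 + s * t) + η * (t * (s * s)) / 8 := by
    field_simp
  have h0 : 0 ≤ η * (t * (s * s)) := by positivity
  rw [h]
  push_cast
  nlinarith

/-- Copies of function-like states are one family of parallel classical queries: each index is
queried `t` times, and the indices themselves are part of the side information. The Haar isometry
maps them to distinct columns of a Haar unitary. -/
lemma isPRFSG_of_isQCompPRI {𝒢 : GateSet} {n m : ℕ → ℕ} (hn : PolyBounded n)
    {F : (κ : ℕ) → Circuit 𝒢 (κ + n κ) (n κ + m κ)} (hF : IsQCompPRI n m F)
    (hneg : Negligible fun κ => ((2 : ℝ) ^ (n κ + m κ))⁻¹) :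
    IsPRFSG n (fun κ => n κ + m κ) F where
  qpt := hF.qpt
  pseudorandom s t a hs ht ha adv hadv x hx D hD := by
    have hτ : ∀ κ, IsDensity (tensor (adv κ) (tensorAll fun i => basisOp (x κ i))) := fun κ =>
      (hadv κ).tensor (by rw [tensorAll_basisOp]; exact isDensity_basisOp _)
    have hc : ∀ κ, Function.Injective fun i => Fin.append (x κ i) (zeros (m κ)) :=
      fun κ i j hij => hx κ (by simpa using congrArg fstPart hij)
    have h1 := hF.negligible_advantage (hs.mul ht) (ha.add (hs.mul hn)) D hD hτ
      fun κ c => x κ c.divNat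
    have h2 := hneg.sqrt.sqrt.polyBounded_mul
      (((PolyBounded.const 1).add (hs.mul ht)).add (ht.mul (hs.mul hs)))
    refine ⟨_, h1.add h2, fun κ => ?_⟩
    have h3 := abs_integral_columns_sub_integral_haarStates_le_sqrt (t := t κ) (D κ) (hτ κ) (hc κ)
    exact (abs_sub_le _ (∫ V, acceptCopies (t := t κ) (D κ)
      (tensor (adv κ) (tensorAll fun i => basisOp (x κ i)))
      (fun i => col V (Fin.append (x κ i) (zeros (m κ)))) ∂haarUnitary (n κ + m κ)) _).trans
      (add_le_add le_rfl h3)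

end QCrypto
end

theorem mainTheorem4 (𝒢 : QCrypto.GateSet) (n m : ℕ → ℕ)
    (hn : QCrypto.PolyBounded n) (hm : QCrypto.PolyBounded m)
    (F : (κ : ℕ) → QCrypto.Circuit 𝒢 (κ + n κ) (n κ + m κ))
    (hF : QCrypto.IsQCompPRI n m F) :
    (∃ G : (κ : ℕ) → QCrypto.Circuit 𝒢 κ (n κ + m κ),
      (∀ (κ : ℕ) (k : QCrypto.Reg κ),
        (G κ).run (QCrypto.basisOp k) =
          QCrypto.keyed (F κ) k (QCrypto.basisOp (QCrypto.zeros (n κ)))) ∧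
      QCrypto.IsPRSG (fun κ => n κ + m κ) G) ∧
    (QCrypto.Negligible (fun κ => ((2 : ℝ) ^ (n κ + m κ))⁻¹) →
      QCrypto.IsPRFSG n (fun κ => n κ + m κ) F) :=
  ⟨⟨fun κ => (F κ).zeroInput, fun κ k => (F κ).run_zeroInput (QCrypto.basisOp k),
    QCrypto.isPRSG_zeroInput hF⟩, QCrypto.isPRFSG_of_isQCompPRI hn hF⟩
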